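/- Let $n\ge 2$ and let $G$ be a free metabelian group of rank $n$, i.e. a group isomorphic to $F/F''$, where $F$ is the free group of rank $n$ and $F''=[[F,F],[F,F]]$. Then the group $G$ (in the language of groups $\{\cdot,{}^{-1},1\}$) and the ring $\mathbb Z$ (in the language of unitary rings) are bi-interpretable with parameters. Here an interpretation with parameters $\bar p$ (a finite tuple in $B$) of a structure $\mathbb A$ in a structure $\mathbb B$ (with underlying sets $A$, $B$) is given by a map $\mu$ from a subset $U\subseteq B^d$, for some $d\in\mathbb N$, onto $A$ (the coordinate map) such that $U$, the equivalence relation $\{(x,y)\in U^2:\mu(x)=\mu(y)\}$, and the full preimages under $\mu$ of the graphs of all functions, relations and constants of $\mathbb A$ are definable in $\mathbb B$ by first-order formulas with parameters $\bar p$. Structures $\mathbb A$ and $\mathbb B$ are bi-interpretable with parameters if there are an interpretation $\Gamma$ of $\mathbb A$ in $\mathbb B$ with parameters $\bar p$ and coordinate map $\mu_\Gamma$, and an interpretation $\Delta$ of $\mathbb B$ in $\mathbb A$ with parameters $\bar q$ and coordinate map $\mu_\Delta$, such that: (a) for some tuple $\bar p_0$ of preimages of the entries of $\bar p$ under $\mu_\Delta$,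 the coordinate map of some isomorphism onto $\mathbb A$ from the copy of $\mathbb A$ interpreted in $\mathbb A$ by the composition $\Gamma\circ\Delta$ (that is, the map $\alpha\circ\mu_\Gamma\circ\mu_\Delta$ for some automorphism $\alpha$ of $\mathbb A$, with $\mu_\Delta$ applied coordinatewise) has a graph definable in $\mathbb A$ with parameters $(\bar p_0,\bar q)$; and (b) symmetrically, for some tuple $\bar q_0$ of preimages of the entries of $\bar q$ under $\mu_\Gamma$, the map $\beta\circ\mu_\Delta\circ\mu_\Gamma$, for some automorphism $\beta$ of $\mathbb B$, has a graph definable in $\mathbb B$ with parameters $(\bar q_0,\bar p)$. -/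

import Mathlib

universe u v w u' v' w'

namespace FirstOrder

/-- The function symbols of the language of groups: multiplication, inversion, identity. -/
inductive GroupFunc : ℕ → Type
  | mul : GroupFunc 2
  | inv : GroupFunc 1
  | one : GroupFunc 0

/-- The first-order language of groups `{·, ⁻¹, 1}`. -/
def Language.groups : Language where
  Functions := GroupFunc
  Relations := fun _ => Empty

/-- Every group is a structure in the language of groups, in the obvious way. -/
instance groupStructure (G : Type w) [Group G] : Language.groups.Structure G where
  funMap {_} f := match f with
    | .mul => fun x => x 0 * x 1
    | .inv => fun x => (x 0)⁻¹
    | .one => fun _ => 1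
  RelMap {_} r := nomatch r

/-- The ring `ℤ` as a structure in Mathlib's language of rings `{+, ·, -, 0, 1}`. -/
instance intRingStructure : Language.ring.Structure ℤ :=
  (Ring.compatibleRingOfRing ℤ).toStructure

/-- Let `μ` be a partial map from `Nⁿ` to `M`, where `n` is the size of `ι`. This is the full
preimage in `(Nⁿ)ᵏ` of a subset `S` of `Mᵏ`, where `k` is the size of `κ`. -/
def fullPreimage {M : Type w} {N : Type w'} {ι κ : Type} (μ : (ι → N) →. M)
    (S : Set (κ → M)) : Set (κ × ι → N) :=
  {x | ∃ a ∈ S, ∀ k, a k ∈ μ (fun i => x (k, i))}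

/-- An interpretation (with parameters) of the `L`-structure `M` in the `L'`-structure `N`,
given by its finite tuple of parameters and by its coordinate map `μ`, a partial map from `Nⁿ`
onto `M`. The domain of `μ`, the kernel of `μ`, and the full preimages under `μ` of the graphs of
all symbols of `L` must be definable in `N` by `L'`-formulas with the given parameters. Then `μ`
induces an isomorphism onto `M` from the structure that these formulas define on the quotient
of the domain by the kernel. -/
structure Interpretation (L : Language.{u, v}) (M : Type w) [L.Structure M]
    (L' : Language.{u', v'}) (N : Type w') [L'.Structure N] where
  /-- the dimension -/
  dim : ℕ
  /-- the number of parameters -/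
  parDim : ℕ
  /-- the parameters -/
  par : Fin parDim → N
  /-- the coordinate map -/
  coord : (Fin dim → N) →. M
  surjective : ∀ a : M, ∃ x, a ∈ coord x
  definable_dom : (Set.range par).Definable L' coord.Dom
  definable_ker : (Set.range par).Definable L'
    (fullPreimage coord {a : Fin 2 → M | a 0 = a 1})
  definable_fun : ∀ {n : ℕ} (f : L.Functions n), (Set.range par).Definable L'
    (fullPreimage coord {a : Fin (n + 1) → M |
      Language.Structure.funMap f (fun i : Fin n => a i.castSucc) = a (Fin.last n)})
  definable_rel : ∀ {n : ℕ} (r : L.Relations n), (Set.range par).Definable L'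
    (fullPreimage coord {a : Fin n → M | Language.Structure.RelMap r a})

section

variable {L : Language.{u, v}} {M : Type w} [L.Structure M]
  {L' : Language.{u', v'}} {N : Type w'} [L'.Structure N]

/-- `Γ.CompRel Δ x a` says that the coordinate map of the composition `Γ ∘ Δ`, an interpretation
of `M` in `M` of dimension `Γ.dim * Δ.dim`, is defined at `x` with value `a`: first `Δ.coord` is
applied to each of the `Γ.dim` blocks of `x`, then `Γ.coord` to the resulting tuple in `N`. -/
def Interpretation.CompRel (Γ : Interpretation L M L' N) (Δ : Interpretation L' N L M)
    (x : Fin Γ.dim × Fin Δ.dim → M) (a : M) : Prop :=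
  ∃ b : Fin Γ.dim → N, (∀ i, b i ∈ Δ.coord (fun j => x (i, j))) ∧ a ∈ Γ.coord b

/-- Some isomorphism from the structure `(Γ ∘ Δ)(M, p*)` onto `M` is definable in `M` with the
parameters `p* = (p₀, q)`, where `q` are the parameters of `Δ` and `p₀` is a tuple of preimages
under `Δ.coord` of the parameters of `Γ`. Since the coordinate map of `Γ ∘ Δ` induces one such
isomorphism, all of them arise by following it with an automorphism `α` of `M`; the definable
set below is the graph of the coordinate map of the isomorphism. -/
def Interpretation.HasDefinableCompIso (Γ : Interpretation L M L' N)
    (Δ : Interpretation L' N L M) : Prop :=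
  ∃ p₀ : Fin Γ.parDim → Fin Δ.dim → M, (∀ k, Γ.par k ∈ Δ.coord (p₀ k)) ∧
    ∃ α : L.Equiv M M,
      (Set.range (fun kj : Fin Γ.parDim × Fin Δ.dim => p₀ kj.1 kj.2) ∪
          Set.range Δ.par).Definable L
        {y : (Fin Γ.dim × Fin Δ.dim) ⊕ Unit → M |
          ∃ a : M, Γ.CompRel Δ (fun ij => y (Sum.inl ij)) a ∧ y (Sum.inr ()) = α a}

end

/-- Bi-interpretability with parameters of the `L`-structure `M` and the `L'`-structure `N`. -/
def BiInterpretable (L : Language.{u, v}) (M : Type w) [L.Structure M]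
    (L' : Language.{u', v'}) (N : Type w') [L'.Structure N] : Prop :=
  ∃ (Γ : Interpretation L M L' N) (Δ : Interpretation L' N L M),
    Γ.HasDefinableCompIso Δ ∧ Δ.HasDefinableCompIso Γ

end FirstOrder

/-- The free metabelian group of rank `n`: the quotient of the free group of rank `n` by its
second derived subgroup. -/
abbrev FreeMetabelianGroup (n : ℕ) : Type :=
  FreeGroup (Fin n) ⧸ derivedSeries (FreeGroup (Fin n)) 2

/-- `G` is a free metabelian group of rank `n`. -/
def IsFreeMetabelianOfRank (G : Type w) [Group G] (n : ℕ) : Prop :=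
  Nonempty (G ≃* FreeMetabelianGroup n)

/-! Both interpretations have total, one-dimensional coordinate maps. `ofInt` sends an integer to
the value in G of the group term that it codes. `toInt` sends an element congruent to x₀^m modulo
the commutator subgroup K to m, and all elements off this axis to 0.

ℤ interprets G because two terms have equal values exactly when their equality is derivable from the
metabelian laws (`value_eq_iff`), and derivability is arithmetical by Gödel's β function
(`dfun_ruleClosure`). G interprets ℤ because K is the centralizer of ⁅x₀, x₁⁆ and commuting elements
have proportional exponent vectors. Centralizers modulo K therefore give lines in the exponent
lattice, whose incidences define multiplication.

It remains to define each coordinate map on the other side. For `toInt` in ℤ it is enough that z ↦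
x₀^z is arithmetical (`dfun_int_toInt`). For `ofInt` in G the key is a relation S(g, t), definable
in G, between elements and integer tuples, such that g is determined by the set of its t
(`eq_iff_forall_sep`). Since ℤ interprets G, the relation S(ofInt z, t) between integers is
arithmetical, hence definable in G. Then ofInt z = g says that S(ofInt z, t) ↔ S(g, t) for all t
(`dfun_group_ofInt`).

To find S, the Magnus embedding identifies K with a torsion-free module W of vectors over the
Laurent ring. Such a vector is determined by its values at the points with coordinates 2^(r i), and
for y in W the value is recorded by a congruence of D • y with an integral combination of the w ⁅x
i, x j⁆ modulo the elements (X_i - N_i) • d_i, d_i in W. Expressing this in G requires powers d^N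
with a variable exponent N; `eq_zpow_iff` defines them by congruences modulo 1 - X₀^p for all p. -/

/-! ### Definable sets, sorts and definable maps -/

/-- A calculus of definable sets on `M`: a family of subsets of the powers of `M` closed under the
first-order operations and containing all singletons. -/
structure Calc (M : Type w) where
  Def : ∀ {α : Type} [Finite α], Set (α → M) → Prop
  compl : ∀ {α : Type} [Finite α] {S : Set (α → M)}, Def S → Def Sᶜ
  inter : ∀ {α : Type} [Finite α] {S T : Set (α → M)}, Def S → Def T → Def (S ∩ T)
  proj : ∀ {α β : Type} [Finite α] [Finite β] {S : Set (α ⊕ β → M)}, Def S →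
    Def {x : α → M | ∃ y : β → M, Sum.elim x y ∈ S}
  comp : ∀ {α β : Type} [Finite α] [Finite β] {S : Set (β → M)} (f : β → α), Def S →
    Def {x : α → M | x ∘ f ∈ S}
  diag : Def {x : Fin 2 → M | x 0 = x 1}
  const : ∀ m : M, Def {x : Unit → M | x () = m}

namespace Calc

variable {M : Type w}

/-- The calculus of the sets definable with parameters in `A`, if all elements are definable. -/
def ofDefinable (L : FirstOrder.Language.{u, v}) [L.Structure M] (A : Set M)
    (h : ∀ m : M, A.Definable L {x : Unit → M | x () = m}) : Calc M where
  Def S := A.Definable L S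
  compl h := h.compl
  inter h h' := h.inter h'
  proj h := h.exists_of_finite
  comp f h := h.preimage_comp f
  diag := Set.Definable.diagonal L A
  const := h

/-- A sort of a calculus: a type with a surjection from a finite power of `M` whose kernel is
definable. -/
class Rep (𝒟 : Calc M) (X : Type*) where
  ι : Type
  fin : Finite ι
  π : (ι → M) → X
  surj : Function.Surjective π
  ker : 𝒟.Def {x : ι ⊕ ι → M | π (x ∘ Sum.inl) = π (x ∘ Sum.inr)}

attribute [instance] Rep.fin

/-- The projection of tuples onto a sort. -/
abbrev pr (𝒟 : Calc M) {X : Type*} [Rep 𝒟 X] (x : Rep.ι 𝒟 X → M) : X := Rep.π x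

/-- A map between sorts is definable if its graph is. -/
@[fun_prop]
def DFun (𝒟 : Calc M) {X : Type*} {Y : Type*} [Rep 𝒟 X] [Rep 𝒟 Y] (f : X → Y) : Prop :=
  𝒟.Def {x : Rep.ι 𝒟 X ⊕ Rep.ι 𝒟 Y → M | f (pr 𝒟 (x ∘ Sum.inl)) = pr 𝒟 (x ∘ Sum.inr)}

variable {𝒟 : Calc M} {α β γ : Type} [Finite α] [Finite β] [Finite γ]

theorem Def.of_eq {S T : Set (α → M)} (h : 𝒟.Def S) (e : ∀ x, x ∈ T ↔ x ∈ S) : 𝒟.Def T := by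
  rwa [Set.ext e]

/-- The index type may be empty, so a trivial equation is written for an auxiliary coordinate. The
empty set is what gets projected, because `M` is not assumed inhabited. -/
theorem def_univ : 𝒟.Def (Set.univ : Set (α → M)) := by
  have h := 𝒟.comp (fun _ => Sum.inl () : Fin 2 → Unit ⊕ α) 𝒟.diag
  have h2 := 𝒟.inter h (𝒟.compl h)
  have h3 := 𝒟.compl (𝒟.comp (fun i : Unit ⊕ α => i) h2)
  have h4 := 𝒟.compl (𝒟.proj (𝒟.comp Sum.swap (𝒟.compl h3)))
  refine h4.of_eq fun x => ?_
  simp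

theorem def_and {p q : (α → M) → Prop} (hp : 𝒟.Def {x | p x}) (hq : 𝒟.Def {x | q x}) :
    𝒟.Def {x | p x ∧ q x} := 𝒟.inter hp hq

theorem def_not {p : (α → M) → Prop} (hp : 𝒟.Def {x | p x}) : 𝒟.Def {x | ¬ p x} := 𝒟.compl hp

theorem def_or {p q : (α → M) → Prop} (hp : 𝒟.Def {x | p x}) (hq : 𝒟.Def {x | q x}) :
    𝒟.Def {x | p x ∨ q x} := by
  refine (def_not (def_and (def_not hp) (def_not hq))).of_eq fun x => ?_
  simp only [Set.mem_ofPred_eq]; tauto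

theorem def_imp {p q : (α → M) → Prop} (hp : 𝒟.Def {x | p x}) (hq : 𝒟.Def {x | q x}) :
    𝒟.Def {x | p x → q x} := by
  refine (def_or (def_not hp) hq).of_eq fun x => ?_
  simp only [Set.mem_ofPred_eq]; tauto

theorem def_iff {p q : (α → M) → Prop} (hp : 𝒟.Def {x | p x}) (hq : 𝒟.Def {x | q x}) :
    𝒟.Def {x | p x ↔ q x} := by
  refine (def_and (def_imp hp hq) (def_imp hq hp)).of_eq fun x => ?_
  simp only [Set.mem_ofPred_eq]; tauto

theorem def_ex {p : (α → M) → (β → M) → Prop}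
    (hp : 𝒟.Def {x : α ⊕ β → M | p (x ∘ Sum.inl) (x ∘ Sum.inr)}) :
    𝒟.Def {x | ∃ y, p x y} := by
  refine (𝒟.proj hp).of_eq fun x => ?_
  simp [Sum.elim_comp_inl, Sum.elim_comp_inr]

theorem def_comp {p : (β → M) → Prop} (f : β → α) (hp : 𝒟.Def {x | p x}) :
    𝒟.Def {x : α → M | p (x ∘ f)} := 𝒟.comp f hp

theorem def_eq (a b : α) : 𝒟.Def {x : α → M | x a = x b} :=
  𝒟.comp ![a, b] 𝒟.diag

theorem def_const (a : α) (m : M) : 𝒟.Def {x : α → M | x a = m} :=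
  𝒟.comp (fun _ => a) (𝒟.const m)

theorem def_forall_fin {p : β → (α → M) → Prop} (hp : ∀ b, 𝒟.Def {x | p b x}) :
    𝒟.Def {x | ∀ b, p b x} := by
  have : ∀ s : Set β, s.Finite → 𝒟.Def {x | ∀ b ∈ s, p b x} := by
    intro s hs
    induction s, hs using Set.Finite.induction_on with
    | empty => exact def_univ.of_eq (by simp)
    | @insert a s _ _ ih => exact (def_and (hp a) ih).of_eq (by simp)
  exact (this Set.univ Set.finite_univ).of_eq (by simp)

section sorts

variable {X Y Z : Type*} [Rep 𝒟 X] [Rep 𝒟 Y] [Rep 𝒟 Z]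

instance instBase : Rep 𝒟 M where
  ι := Unit
  fin := inferInstance
  π x := x ()
  surj m := ⟨fun _ => m, rfl⟩
  ker := def_eq _ _

instance instProd : Rep 𝒟 (X × Y) where
  ι := Rep.ι 𝒟 X ⊕ Rep.ι 𝒟 Y
  fin := inferInstance
  π x := (pr 𝒟 (x ∘ Sum.inl), pr 𝒟 (x ∘ Sum.inr))
  surj p := by
    obtain ⟨a, ha⟩ := Rep.surj (𝒟 := 𝒟) p.1
    obtain ⟨b, hb⟩ := Rep.surj (𝒟 := 𝒟) p.2
    exact ⟨Sum.elim a b, by simp [ha, hb]⟩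
  ker := by
    simp only [Prod.mk.injEq]
    exact def_and (def_comp (Sum.map Sum.inl Sum.inl) (Rep.ker (𝒟 := 𝒟) (X := X)))
      (def_comp (Sum.map Sum.inr Sum.inr) (Rep.ker (𝒟 := 𝒟) (X := Y)))

instance instPi {κ : Type} [Finite κ] : Rep 𝒟 (κ → X) where
  ι := κ × Rep.ι 𝒟 X
  fin := inferInstance
  π x := fun k => pr 𝒟 (fun i => x (k, i))
  surj p := by
    choose a ha using fun k => Rep.surj (𝒟 := 𝒟) (p k)
    exact ⟨fun q => a q.1 q.2, by simp [ha]⟩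
  ker := by
    simp only [funext_iff]
    exact def_forall_fin fun k =>
      def_comp (Sum.map (Prod.mk k) (Prod.mk k)) (Rep.ker (𝒟 := 𝒟) (X := X))

/-- With truth values as a sort, definable predicates are definable maps, and `fun_prop` handles
formulas and terms alike. A pair codes the equality of its entries; coding falsehood takes two
distinct elements. -/
instance instProp [Nontrivial M] : Rep 𝒟 Prop where
  ι := Fin 2
  fin := inferInstance
  π x := x 0 = x 1
  surj p := by
    obtain ⟨a, b, hab⟩ := exists_pair_ne M
    by_cases h : p
    · exact ⟨fun _ => a, by simp [h]⟩
    · exact ⟨![a, b], by simp [h, hab]⟩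
  ker := by
    simp only [eq_iff_iff]
    exact def_iff (def_eq _ _) (def_eq _ _)

@[fun_prop]
theorem DFun.id : 𝒟.DFun (fun x : X => x) := Rep.ker

theorem DFun.comp {g : Y → Z} {f : X → Y} (hg : 𝒟.DFun g) (hf : 𝒟.DFun f) :
    𝒟.DFun (fun x => g (f x)) := by
  have h1 := def_comp (α := (Rep.ι 𝒟 X ⊕ Rep.ι 𝒟 Z) ⊕ Rep.ι 𝒟 Y)
    (Sum.elim (Sum.inl ∘ Sum.inl) Sum.inr) hf
  have h2 := def_comp (α := (Rep.ι 𝒟 X ⊕ Rep.ι 𝒟 Z) ⊕ Rep.ι 𝒟 Y)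
    (Sum.elim Sum.inr (Sum.inl ∘ Sum.inr)) hg
  refine (def_ex (p := fun x y => f (pr 𝒟 (x ∘ Sum.inl)) = pr 𝒟 y ∧
    g (pr 𝒟 y) = pr 𝒟 (x ∘ Sum.inr)) (def_and h1 h2)).of_eq fun x => ?_
  simp only [Set.mem_ofPred_eq]
  constructor
  · intro h
    obtain ⟨y, hy⟩ := Rep.surj (𝒟 := 𝒟) (f (pr 𝒟 (x ∘ Sum.inl)))
    exact ⟨y, hy.symm, (congrArg g hy).trans h⟩
  · rintro ⟨y, hy, h⟩
    rw [hy, h]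

attribute [fun_prop] DFun.comp

theorem DFun.const (y : Y) : 𝒟.DFun (fun _ : X => y) := by
  obtain ⟨a, rfl⟩ := Rep.surj (𝒟 := 𝒟) y
  have h1 : 𝒟.Def {x : Rep.ι 𝒟 Y → M | ∀ i, x i = a i} := def_forall_fin fun i => def_const i (a i)
  have h2 := def_comp (α := (Rep.ι 𝒟 X ⊕ Rep.ι 𝒟 Y) ⊕ Rep.ι 𝒟 Y) Sum.inr h1
  have h3 := def_comp (α := (Rep.ι 𝒟 X ⊕ Rep.ι 𝒟 Y) ⊕ Rep.ι 𝒟 Y)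
    (Sum.elim Sum.inr (Sum.inl ∘ Sum.inr)) (Rep.ker (𝒟 := 𝒟) (X := Y))
  refine (def_ex (p := fun x y => (∀ i, y i = a i) ∧
    pr 𝒟 y = pr 𝒟 (x ∘ Sum.inr)) (def_and h2 h3)).of_eq fun x => ?_
  simp only [Set.mem_ofPred_eq]
  constructor
  · exact fun h => ⟨a, fun _ => rfl, h⟩
  · rintro ⟨y, hy, h⟩
    rwa [← funext hy]

attribute [fun_prop] DFun.const

theorem DFun.prodMk {f : X → Y} {g : X → Z} (hf : 𝒟.DFun f) (hg : 𝒟.DFun g) :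
    𝒟.DFun (fun x => (f x, g x)) := by
  refine (def_and (def_comp (Sum.map (fun i => i) Sum.inl) hf)
    (def_comp (Sum.map (fun i => i) Sum.inr) hg)).of_eq fun x => ?_
  simp only [Set.mem_ofPred_eq]
  exact Prod.mk_inj

attribute [fun_prop] DFun.prodMk

@[fun_prop]
theorem DFun.fst : 𝒟.DFun (fun p : X × Y => p.1) :=
  def_comp (Sum.map Sum.inl (fun i => i)) (Rep.ker (𝒟 := 𝒟) (X := X))

@[fun_prop]
theorem DFun.snd : 𝒟.DFun (fun p : X × Y => p.2) :=
  def_comp (Sum.map Sum.inr (fun i => i)) (Rep.ker (𝒟 := 𝒟) (X := Y))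

@[fun_prop]
theorem DFun.pi {κ : Type} [Finite κ] {f : X → κ → Y} (hf : ∀ k, 𝒟.DFun (fun x => f x k)) :
    𝒟.DFun f := by
  refine (def_forall_fin fun k => def_comp (Sum.map (fun i => i) (Prod.mk k)) (hf k)).of_eq
    fun x => ?_
  simp only [Set.mem_ofPred_eq]
  exact funext_iff

@[fun_prop]
theorem DFun.apply {κ : Type} [Finite κ] (k : κ) : 𝒟.DFun (fun x : κ → X => x k) :=
  def_comp (Sum.map (Prod.mk k) (fun i => i)) (Rep.ker (𝒟 := 𝒟) (X := X))

variable [Nontrivial M]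

theorem dfun_prop_iff {P : X → Prop} : 𝒟.DFun P ↔ 𝒟.Def {x | P (pr 𝒟 x)} := by
  constructor
  · intro h
    have h1 := def_comp (α := Rep.ι 𝒟 X ⊕ Fin 2) (fun i => i) h
    have h2 : 𝒟.Def {x : Rep.ι 𝒟 X ⊕ Fin 2 → M | x (Sum.inr 0) = x (Sum.inr 1)} := def_eq _ _
    refine (def_ex (p := fun x y => (P (pr 𝒟 x) = (y 0 = y 1)) ∧ y 0 = y 1)
      (def_and h1 h2)).of_eq fun x => ?_
    simp only [Set.mem_ofPred_eq]
    constructor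
    · intro h
      obtain ⟨a, _⟩ := exists_pair_ne M
      exact ⟨fun _ => a, by simp [h], rfl⟩
    · rintro ⟨y, hy, h⟩
      rw [hy]; exact h
  · intro h
    refine (def_iff (def_comp (Sum.inl : _ → Rep.ι 𝒟 X ⊕ Fin 2) h)
      (def_eq (Sum.inr 0) (Sum.inr 1))).of_eq fun x => ?_
    simp only [Set.mem_ofPred_eq]
    exact eq_iff_iff

@[fun_prop]
theorem DFun.and {P Q : X → Prop} (hp : 𝒟.DFun P) (hq : 𝒟.DFun Q) :
    𝒟.DFun (fun x => P x ∧ Q x) := by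
  rw [dfun_prop_iff] at *; exact def_and hp hq

@[fun_prop]
theorem DFun.or {P Q : X → Prop} (hp : 𝒟.DFun P) (hq : 𝒟.DFun Q) :
    𝒟.DFun (fun x => P x ∨ Q x) := by
  rw [dfun_prop_iff] at *; exact def_or hp hq

@[fun_prop]
theorem DFun.not {P : X → Prop} (hp : 𝒟.DFun P) : 𝒟.DFun (fun x => ¬ P x) := by
  rw [dfun_prop_iff] at *; exact def_not hp

@[fun_prop]
theorem DFun.iff {P Q : X → Prop} (hp : 𝒟.DFun P) (hq : 𝒟.DFun Q) :
    𝒟.DFun (fun x => P x ↔ Q x) := by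
  rw [dfun_prop_iff] at *; exact def_iff hp hq

@[fun_prop]
theorem DFun.imp {P Q : X → Prop} (hp : 𝒟.DFun P) (hq : 𝒟.DFun Q) :
    𝒟.DFun (fun x => P x → Q x) := by
  rw [dfun_prop_iff] at *; exact def_imp hp hq

@[fun_prop]
theorem DFun.ex {P : X → Y → Prop} (hp : 𝒟.DFun (fun p : X × Y => P p.1 p.2)) :
    𝒟.DFun (fun x => ∃ y, P x y) := by
  rw [dfun_prop_iff] at *
  refine (def_ex (p := fun x y => P (pr 𝒟 x) (pr 𝒟 y)) hp).of_eq fun x => ?_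
  simp only [Set.mem_ofPred_eq]
  exact (Rep.surj (𝒟 := 𝒟)).exists

@[fun_prop]
theorem DFun.all {P : X → Y → Prop} (hp : 𝒟.DFun (fun p : X × Y => P p.1 p.2)) :
    𝒟.DFun (fun x => ∀ y, P x y) := by
  have h : 𝒟.DFun (fun x => ¬ ∃ y, ¬ P x y) := by fun_prop
  simpa using h

theorem DFun.all_fin {κ : Type} [Finite κ] {P : X → κ → Prop}
    (hp : ∀ k, 𝒟.DFun (fun x => P x k)) : 𝒟.DFun (fun x => ∀ k, P x k) := by
  simp only [dfun_prop_iff] at *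
  exact def_forall_fin hp

@[fun_prop]
theorem DFun.eq {f g : X → Y} (hf : 𝒟.DFun f) (hg : 𝒟.DFun g) :
    𝒟.DFun (fun x => f x = g x) := by
  have h : 𝒟.DFun (fun p : Y × Y => p.1 = p.2) := dfun_prop_iff.2 Rep.ker
  exact h.comp (hf.prodMk hg)

/-- A map is definable if its graph is. -/
theorem DFun.of_graph {f : X → Y} (h : 𝒟.DFun (fun p : X × Y => f p.1 = p.2)) : 𝒟.DFun f := by
  rw [dfun_prop_iff] at h
  exact h

@[fun_prop]
theorem DFun.ite {P : X → Prop} [∀ x, Decidable (P x)] {f g : X → Y}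
    (hP : 𝒟.DFun P) (hf : 𝒟.DFun f) (hg : 𝒟.DFun g) :
    𝒟.DFun (fun x => if P x then f x else g x) := by
  refine DFun.of_graph ?_
  have : 𝒟.DFun (fun p : X × Y => (P p.1 ∧ f p.1 = p.2) ∨ (¬ P p.1 ∧ g p.1 = p.2)) := by fun_prop
  convert this using 2 with p
  split_ifs with h <;> simp [h]

theorem dfun_base_prop_iff {P : (α → M) → Prop} : 𝒟.DFun P ↔ 𝒟.Def {x | P x} := by
  rw [dfun_prop_iff]
  constructor
  · intro h
    exact def_comp (fun i : α × Unit => i.1) h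
  · intro h
    exact def_comp (fun i : α => (i, ())) h

open FirstOrder FirstOrder.Language in
omit [Nontrivial M] in
theorem DFun.funMap (L : FirstOrder.Language.{u, v}) [L.Structure M] (A : Set M)
    (h : ∀ m : M, A.Definable L {x : Unit → M | x () = m}) {n : ℕ} (f : L.Functions n) :
    (ofDefinable L A h).DFun (fun x : Fin n → M => Structure.funMap f x) := by
  refine Set.Definable.mono (Set.empty_definable_iff.2
    ⟨Term.equal (.func f fun i => .var (Sum.inl (i, ()))) (.var (Sum.inr ())), ?_⟩)
    (Set.empty_subset A)
  ext x
  simp only [Set.mem_ofPred_eq, Formula.realize_equal, Term.realize_func, Term.realize_var]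
  rfl

section formulas

open FirstOrder FirstOrder.Language

variable (L : FirstOrder.Language.{u', v'}) {T : Type w'} [L.Structure T] [Rep 𝒟 T]

/-- Sets definable in a structure on a sort are definable in the calculus if the basic functions and
relations of the structure are. -/
theorem DFun.of_definable
    (hf : ∀ {n : ℕ} (f : L.Functions n), 𝒟.DFun (fun x : Fin n → T => Structure.funMap f x))
    (hr : ∀ {n : ℕ} (r : L.Relations n), 𝒟.DFun (fun x : Fin n → T => Structure.RelMap r x))
    {A : Set T} {S : Set (α → T)} (hS : A.Definable L S) : 𝒟.DFun (fun x => x ∈ S) := by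
  have hterm : ∀ {X : Type w'} [Rep 𝒟 X] {β : Type w'} (t : L.Term β) (v : X → β → T),
      (∀ b, 𝒟.DFun (fun x => v x b)) → 𝒟.DFun (fun x => t.realize (v x)) := by
    intro X _ β t v hv
    induction t with
    | var b => exact hv b
    | func f ts ih => exact (hf f).comp (DFun.pi ih)
  have hform : ∀ {β : Type w'} {n : ℕ} (φ : L.BoundedFormula β n) (v : (α → T) → β → T),
      (∀ b, 𝒟.DFun (fun x => v x b)) →
      𝒟.DFun (fun p : (α → T) × (Fin n → T) => φ.Realize (v p.1) p.2) := by
    intro β n φ v hv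
    have hsum : ∀ {n : ℕ} (b : β ⊕ Fin n),
        𝒟.DFun (fun p : (α → T) × (Fin n → T) => Sum.elim (v p.1) p.2 b) := by
      rintro n (b | b)
      · exact (hv b).comp DFun.fst
      · exact (DFun.apply b).comp DFun.snd
    induction φ with
    | falsum => exact DFun.const False
    | equal t₁ t₂ => exact (hterm t₁ _ hsum).eq (hterm t₂ _ hsum)
    | rel r ts => exact (hr r).comp (DFun.pi fun i => hterm (ts i) _ hsum)
    | imp _ _ ih₁ ih₂ => exact ih₁.imp ih₂
    | @all n φ ih =>
      refine DFun.all (P := fun (p : (α → T) × (Fin n → T)) (a : T) =>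
        φ.Realize (v p.1) (Fin.snoc p.2 a)) ?_
      refine ih.comp (f := fun q : ((α → T) × (Fin n → T)) × T =>
        (q.1.1, (Fin.snoc q.1.2 q.2 : Fin (n + 1) → T))) (DFun.prodMk (by fun_prop) (DFun.pi ?_))
      intro i
      induction i using Fin.lastCases with
      | last => simpa using DFun.snd
      | cast i =>
        simp only [Fin.snoc_castSucc]
        fun_prop
  obtain ⟨φ, rfl⟩ := Set.definable_iff_exists_formula_sum.1 hS
  have h : ∀ b, 𝒟.DFun (fun x : α → T => Sum.elim (fun a : A => (a : T)) x b) := by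
    rintro (a | b)
    · exact DFun.const _
    · exact DFun.apply b
  exact (hform (β := A ⊕ α) φ _ h).comp (f := fun x => (x, fun i : Fin 0 => i.elim0))
    (by fun_prop)

end formulas

end sorts

end Calc

/-! ### Definability in the ring of integers -/

open FirstOrder FirstOrder.Language

theorem definable_int_const (m : ℤ) :
    (∅ : Set ℤ).Definable Language.ring {x : Unit → ℤ | x () = m} := by
  have key : ∃ t : Language.ring.Term Unit, ∀ v : Unit → ℤ, t.realize v = m := by
    induction m using Int.induction_on with
    | zero => exact ⟨Functions.apply₂ Ring.addFunc (.func Ring.zeroFunc ![]) (.func Ring.zeroFunc ![]),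
        fun v => rfl⟩
    | succ i ih =>
      obtain ⟨t, ht⟩ := ih
      refine ⟨Functions.apply₂ Ring.addFunc t (.func Ring.oneFunc ![]), fun v => ?_⟩
      rw [Term.realize_functions_apply₂, ht]
      rfl
    | pred i ih =>
      obtain ⟨t, ht⟩ := ih
      refine ⟨Functions.apply₂ Ring.addFunc t (Functions.apply₁ Ring.negFunc
        (.func Ring.oneFunc ![])), fun v => ?_⟩
      rw [Term.realize_functions_apply₂, ht]
      rfl
  obtain ⟨t, ht⟩ := key
  refine Set.empty_definable_iff.2 ⟨Term.equal (.var ()) t, ?_⟩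
  ext x
  simp [Formula.realize_equal, ht]

/-- The calculus of the subsets of powers of `ℤ` that are definable in the ring `ℤ`. -/
def intCalc : Calc ℤ := Calc.ofDefinable Language.ring ∅ definable_int_const

namespace Calc

variable {X : Type*} [Rep intCalc X]

theorem dfun_funMap_int {n : ℕ} (f : Language.ring.Functions n) :
    intCalc.DFun (fun x : Fin n → ℤ => Structure.funMap f x) :=
  DFun.funMap Language.ring ∅ definable_int_const f

@[fun_prop]
theorem DFun.int_add {f g : X → ℤ} (hf : intCalc.DFun f) (hg : intCalc.DFun g) :
    intCalc.DFun (fun x => f x + g x) :=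
  (dfun_funMap_int Ring.addFunc).comp (f := fun x => ![f x, g x])
    (DFun.pi fun i => by fin_cases i <;> assumption)

@[fun_prop]
theorem DFun.int_mul {f g : X → ℤ} (hf : intCalc.DFun f) (hg : intCalc.DFun g) :
    intCalc.DFun (fun x => f x * g x) :=
  (dfun_funMap_int Ring.mulFunc).comp (f := fun x => ![f x, g x])
    (DFun.pi fun i => by fin_cases i <;> assumption)

@[fun_prop]
theorem DFun.int_neg {f : X → ℤ} (hf : intCalc.DFun f) : intCalc.DFun (fun x => - f x) :=
  (dfun_funMap_int Ring.negFunc).comp (f := fun x => ![f x])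
    (DFun.pi fun i => by fin_cases i; assumption)

/-- Lagrange's four square theorem makes the order definable from the ring operations. -/
theorem int_le_iff_four_squares (a b : ℤ) :
    a ≤ b ↔ ∃ p q r s : ℤ, b = a + (p * p + q * q + r * r + s * s) := by
  constructor
  · intro h
    obtain ⟨p, q, r, s, e⟩ := Nat.sum_four_squares (b - a).toNat
    refine ⟨p, q, r, s, ?_⟩
    have : ((b - a).toNat : ℤ) = b - a := Int.toNat_of_nonneg (by omega)
    rw [← e] at this
    push_cast at this
    linarith
  · rintro ⟨p, q, r, s, rfl⟩
    nlinarith [mul_self_nonneg p, mul_self_nonneg q, mul_self_nonneg r, mul_self_nonneg s]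

@[fun_prop]
theorem DFun.int_le {f g : X → ℤ} (hf : intCalc.DFun f) (hg : intCalc.DFun g) :
    intCalc.DFun (fun x => f x ≤ g x) := by
  simp only [int_le_iff_four_squares]
  fun_prop

/-- The natural numbers as a sort of `ℤ`, through the absolute value. -/
instance instNat : Rep intCalc ℕ where
  ι := Unit
  fin := inferInstance
  π x := (x ()).natAbs
  surj m := ⟨fun _ => m, rfl⟩
  ker := by
    have : intCalc.DFun (fun x : Unit ⊕ Unit → ℤ =>
        x (Sum.inl ()) = x (Sum.inr ()) ∨ x (Sum.inl ()) = - x (Sum.inr ())) := by fun_prop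
    refine (dfun_base_prop_iff.1 this).of_eq fun x => ?_
    exact Int.natAbs_eq_natAbs_iff

theorem dfun_natAbs' : intCalc.DFun Int.natAbs := Rep.ker (𝒟 := intCalc) (X := ℕ)

@[fun_prop]
theorem DFun.natAbs {f : X → ℤ} (hf : intCalc.DFun f) : intCalc.DFun (fun x => (f x).natAbs) :=
  dfun_natAbs'.comp hf

@[fun_prop]
theorem DFun.natCast {f : X → ℕ} (hf : intCalc.DFun f) : intCalc.DFun (fun x => (f x : ℤ)) := by
  refine DFun.comp (g := fun m : ℕ => (m : ℤ)) (DFun.of_graph ?_) hf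
  have : intCalc.DFun (fun p : ℕ × ℤ => 0 ≤ p.2 ∧ p.2.natAbs = p.1) := by fun_prop
  convert this using 2 with p
  omega

@[fun_prop]
theorem DFun.nat_add {f g : X → ℕ} (hf : intCalc.DFun f) (hg : intCalc.DFun g) :
    intCalc.DFun (fun x => f x + g x) := by
  have : intCalc.DFun (fun x => ((f x : ℤ) + (g x : ℤ)).natAbs) := by fun_prop
  exact this

@[fun_prop]
theorem DFun.nat_mul {f g : X → ℕ} (hf : intCalc.DFun f) (hg : intCalc.DFun g) :
    intCalc.DFun (fun x => f x * g x) := by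
  have : intCalc.DFun (fun x => ((f x : ℤ) * (g x : ℤ)).natAbs) := by fun_prop
  simpa [Int.natAbs_mul] using this

@[fun_prop]
theorem DFun.nat_le {f g : X → ℕ} (hf : intCalc.DFun f) (hg : intCalc.DFun g) :
    intCalc.DFun (fun x => f x ≤ g x) := by
  have : intCalc.DFun (fun x => (f x : ℤ) ≤ (g x : ℤ)) := by fun_prop
  simpa using this

@[fun_prop]
theorem DFun.nat_lt {f g : X → ℕ} (hf : intCalc.DFun f) (hg : intCalc.DFun g) :
    intCalc.DFun (fun x => f x < g x) := by
  have : intCalc.DFun (fun x => f x + 1 ≤ g x) := by fun_prop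
  exact this

@[fun_prop]
theorem DFun.nat_mod {f g : X → ℕ} (hf : intCalc.DFun f) (hg : intCalc.DFun g) :
    intCalc.DFun (fun x => f x % (g x + 1)) := by
  refine DFun.comp (g := fun p : ℕ × ℕ => p.1 % (p.2 + 1)) (f := fun x => (f x, g x))
    (DFun.of_graph ?_) (by fun_prop)
  have : intCalc.DFun (fun p : (ℕ × ℕ) × ℕ =>
    p.2 < p.1.2 + 1 ∧ ∃ q, p.1.1 = p.2 + (p.1.2 + 1) * q) := by fun_prop
  convert this using 2 with p
  refine ⟨fun h => ⟨h ▸ Nat.mod_lt _ (Nat.succ_pos _), p.1.1 / (p.1.2 + 1), ?_⟩, ?_⟩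
  · rw [← h, Nat.mod_add_div]
  · rintro ⟨h, q, e⟩
    rw [e, Nat.add_mul_mod_self_left, Nat.mod_eq_of_lt h]

@[fun_prop]
theorem DFun.nat_pair {f g : X → ℕ} (hf : intCalc.DFun f) (hg : intCalc.DFun g) :
    intCalc.DFun (fun x => Nat.pair (f x) (g x)) := by
  have : intCalc.DFun (fun x => if f x < g x then g x * g x + f x else f x * f x + f x + g x) := by
    fun_prop
  simpa only [Nat.pair] using this

end Calc

/-! ### Inductive generation is arithmetical -/

/-- The set of natural numbers generated by axioms and by a rule with two premises. -/
inductive RuleClosure (Ax : ℕ → Prop) (St : ℕ → ℕ → ℕ → Prop) : ℕ → Prop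
  | ax {c : ℕ} : Ax c → RuleClosure Ax St c
  | step {a b c : ℕ} : RuleClosure Ax St a → RuleClosure Ax St b → St a b c → RuleClosure Ax St c

section derivations

variable {Ax : ℕ → Prop} {St : ℕ → ℕ → ℕ → Prop}

/-- A list of natural numbers in which each entry is an axiom or follows from earlier entries. -/
def IsDerivation (Ax : ℕ → Prop) (St : ℕ → ℕ → ℕ → Prop) (f : ℕ → ℕ) (l : ℕ) : Prop :=
  ∀ i, i < l → (Ax (f i) ∨ ∃ j k, j < i ∧ k < i ∧ St (f j) (f k) (f i))

theorem RuleClosure.of_derivation {f : ℕ → ℕ} {l : ℕ} (h : IsDerivation Ax St f l) (i : ℕ)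
    (hi : i < l) : RuleClosure Ax St (f i) := by
  induction i using Nat.strong_induction_on with
  | _ i ih =>
    rcases h i hi with h | ⟨j, k, hj, hk, h⟩
    · exact .ax h
    · exact .step (ih j hj (by omega)) (ih k hk (by omega)) h

/-- Derivations of the two premises are concatenated and the conclusion is appended; references
inside the second list shift by the length of the first. -/
theorem RuleClosure.exists_list {c : ℕ} (h : RuleClosure Ax St c) :
    ∃ L : List ℕ, IsDerivation Ax St (fun i => L.getD i 0) L.length ∧
      ∃ i, i < L.length ∧ L.getD i 0 = c := by
  induction h with
  | @ax c h => exact ⟨[c], fun i hi => Or.inl (by simp at hi; simpa [hi] using h), 0, by simp, by simp⟩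
  | @step a b c _ _ h ih₁ ih₂ =>
    obtain ⟨L₁, d₁, i₁, h₁, rfl⟩ := ih₁
    obtain ⟨L₂, d₂, i₂, h₂, rfl⟩ := ih₂
    have e₁ : ∀ i, i < L₁.length → (L₁ ++ L₂ ++ [c]).getD i 0 = L₁.getD i 0 := fun i hi => by
      rw [List.append_assoc, List.getD_append _ _ _ _ hi]
    have e₂ : ∀ i, i < L₂.length → (L₁ ++ L₂ ++ [c]).getD (L₁.length + i) 0 = L₂.getD i 0 :=
      fun i hi => by
        rw [List.append_assoc, List.getD_append_right _ _ _ _ (by omega), Nat.add_sub_cancel_left,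
          List.getD_append _ _ _ _ hi]
    have e₃ : (L₁ ++ L₂ ++ [c]).getD (L₁.length + L₂.length) 0 = c := by
      rw [List.getD_append_right _ _ _ _ (by simp)]
      simp
    refine ⟨L₁ ++ L₂ ++ [c], fun i hi => ?_, L₁.length + L₂.length, by simp, e₃⟩
    simp only [List.length_append, List.length_singleton] at hi
    beta_reduce
    rcases lt_or_ge i L₁.length with hi₁ | hi₁
    · rw [e₁ i hi₁]
      refine (d₁ i hi₁).imp id ?_
      rintro ⟨j, k, hj, hk, h⟩
      exact ⟨j, k, hj, hk, by rwa [e₁ j (by omega), e₁ k (by omega)]⟩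
    · obtain ⟨i, rfl⟩ := Nat.exists_eq_add_of_le hi₁
      rcases lt_or_ge i L₂.length with hi₂ | hi₂
      · rw [e₂ i hi₂]
        refine (d₂ i hi₂).imp id ?_
        rintro ⟨j, k, hj, hk, h⟩
        exact ⟨L₁.length + j, L₁.length + k, by omega, by omega,
          by rwa [e₂ j (by omega), e₂ k (by omega)]⟩
      · obtain rfl : i = L₂.length := by omega
        rw [e₃]
        exact Or.inr ⟨i₁, L₁.length + i₂, by omega, by omega, by rwa [e₁ _ h₁, e₂ _ h₂]⟩

/-- Gödel's β function codes a finite list by two numbers `a`, `b`, which turns quantification over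
derivations into quantification over numbers. -/
theorem ruleClosure_iff (c : ℕ) : RuleClosure Ax St c ↔ ∃ a b l : ℕ,
    IsDerivation Ax St (fun i => a % ((i + 1) * b + 1)) l ∧
      ∃ i, i < l ∧ a % ((i + 1) * b + 1) = c := by
  constructor
  · intro h
    obtain ⟨L, hL, i, hi, rfl⟩ := h.exists_list
    have key : ∀ i, i < L.length →
        (Nat.unbeta L).unpair.1 % ((i + 1) * (Nat.unbeta L).unpair.2 + 1) = L.getD i 0 := by
      intro i hi
      have := Nat.beta_unbeta_coe L ⟨i, hi⟩
      rw [Nat.beta] at this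
      rw [List.getD_eq_getElem _ _ hi]
      exact this
    refine ⟨(Nat.unbeta L).unpair.1, (Nat.unbeta L).unpair.2, L.length, fun i hi => ?_, i, hi,
      key i hi⟩
    beta_reduce
    rw [key i hi]
    refine (hL i hi).imp id ?_
    rintro ⟨j, k, hj, hk, h⟩
    exact ⟨j, k, hj, hk, by rwa [key j (by omega), key k (by omega)]⟩
  · rintro ⟨a, b, l, h, i, hi, rfl⟩
    exact RuleClosure.of_derivation h i hi

theorem dfun_ruleClosure (hA : intCalc.DFun Ax)
    (hS : intCalc.DFun (fun p : ℕ × ℕ × ℕ => St p.1 p.2.1 p.2.2)) :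
    intCalc.DFun (RuleClosure Ax St) := by
  have hS' : ∀ {X : Type} [Calc.Rep intCalc X] {f g h : X → ℕ}, intCalc.DFun f → intCalc.DFun g →
      intCalc.DFun h → intCalc.DFun (fun x => St (f x) (g x) (h x)) :=
    fun hf hg hh => hS.comp (hf.prodMk (hg.prodMk hh))
  have hA' : ∀ {X : Type} [Calc.Rep intCalc X] {f : X → ℕ}, intCalc.DFun f →
      intCalc.DFun (fun x => Ax (f x)) := fun hf => hA.comp hf
  have : intCalc.DFun (fun c => ∃ a b l : ℕ,
      (∀ i, i < l → (Ax (a % ((i + 1) * b + 1)) ∨ ∃ j k, j < i ∧ k < i ∧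
        St (a % ((j + 1) * b + 1)) (a % ((k + 1) * b + 1)) (a % ((i + 1) * b + 1)))) ∧
      ∃ i, i < l ∧ a % ((i + 1) * b + 1) = c) := by
    fun_prop
  convert this using 2 with c
  exact ruleClosure_iff c

end derivations

/-! ### The universal property of free metabelian groups -/

open scoped commutatorElement

/-- `G` is free on the tuple `x` in the variety of metabelian groups. -/
structure FreeMetabelianOn {G : Type w} [Group G] {n : ℕ} (x : Fin n → G) : Prop where
  closure : Subgroup.closure (Set.range x) = ⊤
  comm : ∀ a b c d : G, Commute ⁅a, b⁆ ⁅c, d⁆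
  lift : ∀ {H : Type} [Group H], (∀ a b c d : H, Commute ⁅a, b⁆ ⁅c, d⁆) → ∀ y : Fin n → H,
    ∃ φ : G →* H, ∀ i, φ (x i) = y i

theorem derivedSeries_two_eq_bot {H : Type*} [Group H] (h : ∀ a b c d : H, Commute ⁅a, b⁆ ⁅c, d⁆) :
    derivedSeries H 2 = ⊥ := by
  rw [derivedSeries_succ, derivedSeries_one, Subgroup.commutator_eq_bot_iff_le_centralizer,
    commutator_eq_closure, Subgroup.closure_le]
  rintro _ ⟨a, b, rfl⟩
  rw [SetLike.mem_coe, Subgroup.centralizer_closure, Subgroup.mem_centralizer_iff]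
  rintro _ ⟨c, d, rfl⟩
  exact h c d a b

/-- After this only generation, the metabelian law and the universal property are used. Targets in
`Type` suffice: the term group, the exponent lattice, the homothety group and the Heisenberg group
all live there. -/
theorem FreeMetabelianOn.exists_of_isFreeMetabelianOfRank {G : Type w} [Group G] {n : ℕ}
    (hG : IsFreeMetabelianOfRank G n) : ∃ x : Fin n → G, FreeMetabelianOn x := by
  obtain ⟨e⟩ := hG
  let q : FreeGroup (Fin n) →* FreeMetabelianGroup n := QuotientGroup.mk' _
  have hq : Function.Surjective q := QuotientGroup.mk'_surjective _
  refine ⟨fun i => e.symm (q (FreeGroup.of i)), ?_, ?_, ?_⟩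
  · have h := FreeGroup.closure_range_of (Fin n)
    have h2 := congrArg (Subgroup.map (e.symm.toMonoidHom.comp q)) h
    rw [MonoidHom.map_closure, Subgroup.map_top_of_surjective _ (e.symm.surjective.comp hq),
      ← Set.range_comp] at h2
    exact h2
  · intro a b c d
    obtain ⟨a, rfl⟩ := (e.symm.surjective.comp hq) a
    obtain ⟨b, rfl⟩ := (e.symm.surjective.comp hq) b
    obtain ⟨c, rfl⟩ := (e.symm.surjective.comp hq) c
    obtain ⟨d, rfl⟩ := (e.symm.surjective.comp hq) d
    have h : ⁅⁅a, b⁆, ⁅c, d⁆⁆ ∈ derivedSeries (FreeGroup (Fin n)) 2 := by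
      rw [derivedSeries_succ, derivedSeries_one]
      exact Subgroup.commutator_mem_commutator
        (Subgroup.commutator_mem_commutator (Subgroup.mem_top _) (Subgroup.mem_top _))
        (Subgroup.commutator_mem_commutator (Subgroup.mem_top _) (Subgroup.mem_top _))
    have h2 : q ⁅⁅a, b⁆, ⁅c, d⁆⁆ = 1 := (QuotientGroup.eq_one_iff _).2 h
    refine commutatorElement_eq_one_iff_commute.1 ?_
    have h3 := congrArg e.symm h2
    simp only [map_commutatorElement, map_one] at h3
    exact h3
  · intro H _ hH y
    have hk : derivedSeries (FreeGroup (Fin n)) 2 ≤ (FreeGroup.lift y).ker := by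
      rw [← Subgroup.map_eq_bot_iff, eq_bot_iff, ← derivedSeries_two_eq_bot hH]
      exact map_derivedSeries_le_derivedSeries _ _
    refine ⟨(QuotientGroup.lift _ (FreeGroup.lift y) hk).comp e.toMonoidHom, fun i => ?_⟩
    rw [MonoidHom.comp_apply]
    have : e.toMonoidHom (e.symm (q (FreeGroup.of i))) = q (FreeGroup.of i) :=
      e.apply_symm_apply _
    rw [this]
    exact FreeGroup.lift_apply_of

/-! ### Coded terms and equational logic -/

namespace MetabelianTerm

/-- The code of the product of two coded terms. -/
abbrev mul (a b : ℕ) : ℕ := Nat.pair 1 (Nat.pair a b)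

/-- The code of the inverse of a coded term. -/
abbrev inv (a : ℕ) : ℕ := Nat.pair 2 a

/-- The code of the unit. -/
abbrev one : ℕ := Nat.pair 3 0

/-- The code of the commutator of two coded terms. -/
abbrev comm (a b : ℕ) : ℕ := mul (mul (mul a b) (inv a)) (inv b)

variable (n : ℕ)

/-- The axioms of the equational theory of metabelian groups, for coded terms. -/
def IsAxiom (e : ℕ) : Prop :=
  (∃ a, e = Nat.pair a a) ∨
  (∃ a b c, e = Nat.pair (mul (mul a b) c) (mul a (mul b c))) ∨
  (∃ a, e = Nat.pair (mul one a) a) ∨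
  (∃ a, e = Nat.pair (mul (inv a) a) one) ∨
  (∃ a b c d, e = Nat.pair (mul (comm a b) (comm c d)) (mul (comm c d) (comm a b))) ∨
  (∃ j, n ≤ j ∧ e = Nat.pair (Nat.pair 0 j) one) ∨
  (∃ t r, 3 ≤ t ∧ e = Nat.pair (Nat.pair t r) one)

/-- The rules of equational logic, for coded terms. -/
def IsRule (e f g : ℕ) : Prop :=
  ∃ a b c d, e = Nat.pair a b ∧ f = Nat.pair c d ∧
    ((b = d ∧ g = Nat.pair a c) ∨ g = Nat.pair (mul a c) (mul b d) ∨ g = Nat.pair (inv a) (inv b))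

/-- Derivable equations between coded terms. -/
def Derivable (a b : ℕ) : Prop := RuleClosure (IsAxiom n) IsRule (Nat.pair a b)

theorem dfun_isAxiom : intCalc.DFun (IsAxiom n) := by
  unfold IsAxiom
  fun_prop

theorem dfun_isRule : intCalc.DFun (fun p : ℕ × ℕ × ℕ => IsRule p.1 p.2.1 p.2.2) := by
  unfold IsRule
  fun_prop

theorem dfun_derivable {X : Type*} [Calc.Rep intCalc X] {f g : X → ℕ} (hf : intCalc.DFun f)
    (hg : intCalc.DFun g) : intCalc.DFun (fun x => Derivable n (f x) (g x)) :=
  (dfun_ruleClosure (dfun_isAxiom n) dfun_isRule).comp (hf.nat_pair hg)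

variable {n}

theorem Derivable.refl (a : ℕ) : Derivable n a a := RuleClosure.ax (.inl ⟨a, rfl⟩)

/-- This single rule, combined with reflexivity, yields both symmetry and transitivity. -/
theorem Derivable.euclid {a b c : ℕ} (h : Derivable n a b) (h' : Derivable n c b) :
    Derivable n a c := .step h h' ⟨a, b, c, b, rfl, rfl, .inl ⟨rfl, rfl⟩⟩

theorem Derivable.symm {a b : ℕ} (h : Derivable n a b) : Derivable n b a :=
  (Derivable.refl b).euclid h

theorem Derivable.trans {a b c : ℕ} (h : Derivable n a b) (h' : Derivable n b c) :
    Derivable n a c := h.euclid h'.symm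

variable (n) in
/-- Coded terms up to derivable equality. -/
def setoid : Setoid ℕ := ⟨Derivable n, .refl, .symm, .trans⟩

variable (n) in
/-- The group of coded terms up to derivable equality. -/
def TermGroup : Type := Quotient (setoid n)

instance : Group (TermGroup n) :=
  letI : Mul (TermGroup n) := ⟨Quotient.map₂ mul fun a b h c d h' =>
    RuleClosure.step h h' ⟨a, b, c, d, rfl, rfl, .inr (.inl rfl)⟩⟩
  letI : Inv (TermGroup n) := ⟨Quotient.map inv fun a b h =>
    -- Every rule has two premises; the one for inverses uses only the first, so `h` is repeated.
    RuleClosure.step h h ⟨a, b, a, b, rfl, rfl, .inr (.inr rfl)⟩⟩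
  letI : One (TermGroup n) := ⟨Quotient.mk _ one⟩
  Group.ofLeftAxioms
    (by
      rintro ⟨a⟩ ⟨b⟩ ⟨c⟩
      exact Quotient.sound (RuleClosure.ax (.inr (.inl ⟨a, b, c, rfl⟩))))
    (by
      rintro ⟨a⟩
      exact Quotient.sound (RuleClosure.ax (.inr (.inr (.inl ⟨a, rfl⟩)))))
    (by
      rintro ⟨a⟩
      exact Quotient.sound (RuleClosure.ax (.inr (.inr (.inr (.inl ⟨a, rfl⟩))))))

theorem termGroup_comm (a b c d : TermGroup n) : Commute ⁅a, b⁆ ⁅c, d⁆ := by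
  induction a using Quotient.inductionOn
  induction b using Quotient.inductionOn
  induction c using Quotient.inductionOn
  induction d using Quotient.inductionOn
  exact Quotient.sound (RuleClosure.ax (.inr (.inr (.inr (.inr (.inl ⟨_, _, _, _, rfl⟩))))))

variable {G : Type w} [Group G]

/-- The value of a coded term at a tuple of elements of a group. -/
def value (x : Fin n → G) (m : ℕ) : G :=
  if _h : m.unpair.1 = 0 then
    if h : m.unpair.2 < n then x ⟨m.unpair.2, h⟩ else 1
  else if h : m.unpair.1 = 1 then
    have h₁ : m.unpair.2.unpair.1 < m :=
      (Nat.unpair_left_le _).trans_lt (by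
        have := Nat.unpair_lt (n := m) (by
          rcases Nat.eq_zero_or_pos m with rfl | h'
          · simp at h
          · exact h')
        have := Nat.add_le_pair m.unpair.1 m.unpair.2
        rw [Nat.pair_unpair] at this
        omega)
    have h₂ : m.unpair.2.unpair.2 < m :=
      (Nat.unpair_right_le _).trans_lt (by
        have := Nat.add_le_pair m.unpair.1 m.unpair.2
        rw [Nat.pair_unpair] at this
        omega)
    value x m.unpair.2.unpair.1 * value x m.unpair.2.unpair.2
  else if h : m.unpair.1 = 2 then
    have h₁ : m.unpair.2 < m := by
      have := Nat.add_le_pair m.unpair.1 m.unpair.2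
      rw [Nat.pair_unpair] at this
      omega
    (value x m.unpair.2)⁻¹
  else 1
termination_by m

variable (x : Fin n → G)

theorem value_gen (j : ℕ) : value x (Nat.pair 0 j) = if h : j < n then x ⟨j, h⟩ else 1 := by
  rw [value]
  simp

theorem value_mul (a b : ℕ) : value x (mul a b) = value x a * value x b := by
  rw [value]
  simp

theorem value_inv (a : ℕ) : value x (inv a) = (value x a)⁻¹ := by
  rw [value]
  simp

theorem value_other (t r : ℕ) (h : 3 ≤ t) : value x (Nat.pair t r) = 1 := by
  rw [value]
  simp [show t ≠ 0 by omega, show t ≠ 1 by omega, show t ≠ 2 by omega]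

theorem value_one : value x one = 1 := value_other x 3 0 le_rfl

theorem value_comm (a b : ℕ) : value x (comm a b) = ⁅value x a, value x b⁆ := by
  simp [value_mul, value_inv, commutatorElement_def]

theorem Derivable.sound (hG : ∀ a b c d : G, Commute ⁅a, b⁆ ⁅c, d⁆) {a b : ℕ}
    (h : Derivable n a b) : value x a = value x b := by
  have key : ∀ e, RuleClosure (IsAxiom n) IsRule e →
      value x e.unpair.1 = value x e.unpair.2 := by
    intro e he
    induction he with
    | ax h =>
      rcases h with ⟨a, rfl⟩ | ⟨a, b, c, rfl⟩ | ⟨a, rfl⟩ | ⟨a, rfl⟩ | ⟨a, b, c, d, rfl⟩ |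
        ⟨j, hj, rfl⟩ | ⟨t, r, ht, rfl⟩ <;> rw [Nat.unpair_pair] <;> dsimp only
      · simp only [value_mul, mul_assoc]
      · rw [value_mul, value_one, one_mul]
      · rw [value_mul, value_inv, value_one, inv_mul_cancel]
      · rw [value_mul x (comm a b), value_mul x (comm c d), value_comm, value_comm]
        exact hG _ _ _ _
      · rw [value_gen, value_one, dif_neg (by omega)]
      · rw [value_other x t r ht, value_one]
    | step _ _ h ih₁ ih₂ =>
      obtain ⟨a, b, c, d, rfl, rfl, h⟩ := h
      rw [Nat.unpair_pair] at ih₁ ih₂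
      dsimp only at ih₁ ih₂
      rcases h with ⟨rfl, rfl⟩ | rfl | rfl <;> rw [Nat.unpair_pair] <;> dsimp only
      · rw [ih₁, ih₂]
      · rw [value_mul, value_mul, ih₁, ih₂]
      · rw [value_inv, value_inv, ih₁]
  have := key _ h
  rwa [Nat.unpair_pair] at this

variable {x} (hx : FreeMetabelianOn x)

include hx

theorem value_surjective : Function.Surjective (value x) := by
  intro g
  have hg : g ∈ Subgroup.closure (Set.range x) := hx.closure ▸ Subgroup.mem_top g
  induction hg using Subgroup.closure_induction with
  | mem _ h =>
    obtain ⟨i, rfl⟩ := h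
    exact ⟨Nat.pair 0 i, by simp [value_gen]⟩
  | one => exact ⟨one, value_one x⟩
  | mul _ _ _ _ h₁ h₂ =>
    obtain ⟨a, rfl⟩ := h₁
    obtain ⟨b, rfl⟩ := h₂
    exact ⟨mul a b, value_mul x a b⟩
  | inv _ _ h =>
    obtain ⟨a, rfl⟩ := h
    exact ⟨inv a, value_inv x a⟩

/-- Completeness: the coded terms modulo derivability form a metabelian group, so the universal
property gives a homomorphism to it from `G`, which sends the value of each code to the class of
that code. The axioms equating meaningless codes with the unit let every natural number count as a
term. -/
theorem value_eq_iff (a b : ℕ) : value x a = value x b ↔ Derivable n a b := by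
  refine ⟨fun h => ?_, Derivable.sound x hx.comm⟩
  obtain ⟨φ, hφ⟩ := hx.lift (H := TermGroup n) termGroup_comm
    fun i => Quotient.mk _ (Nat.pair 0 i)
  have key : ∀ m, φ (value x m) = Quotient.mk (setoid n) m := by
    intro m
    induction m using Nat.strong_induction_on with
    | _ m ih =>
      have hle := Nat.add_le_pair m.unpair.1 m.unpair.2
      obtain ⟨t, r, rfl⟩ : ∃ t r, m = Nat.pair t r := ⟨_, _, (Nat.pair_unpair m).symm⟩
      simp only [Nat.unpair_pair] at hle
      rcases lt_or_ge t 3 with ht | ht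
      · interval_cases t
        · rw [value_gen]
          split_ifs with h
          · exact hφ ⟨r, h⟩
          · rw [map_one]
            exact (Quotient.sound (RuleClosure.ax (.inr (.inr (.inr (.inr (.inr (.inl
              ⟨r, by omega, rfl⟩)))))))).symm
        · obtain ⟨a, b, rfl⟩ : ∃ a b, r = Nat.pair a b := ⟨_, _, (Nat.pair_unpair r).symm⟩
          have := Nat.add_le_pair a b
          rw [value_mul, map_mul, ih a (by omega), ih b (by omega)]
          rfl
        · rw [value_inv, map_inv, ih r (by omega)]
          rfl
      · rw [value_other x t r ht, map_one]
        exact (Quotient.sound (RuleClosure.ax (.inr (.inr (.inr (.inr (.inr (.inr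
          ⟨t, r, ht, rfl⟩)))))))).symm
  exact Quotient.exact ((key a).symm.trans ((congrArg φ h).trans (key b)))

omit hx

end MetabelianTerm

/-! ### The Magnus embedding -/

/-- The group of affine transformations of a module with homothetic linear part. -/
@[ext]
structure HomothetyGroup (R M : Type*) [CommRing R] [AddCommGroup M] [Module R M] where
  lin : Rˣ
  tr : M

namespace HomothetyGroup

variable {R M : Type*} [CommRing R] [AddCommGroup M] [Module R M]

instance : Mul (HomothetyGroup R M) := ⟨fun a b => ⟨a.lin * b.lin, a.tr + (a.lin : R) • b.tr⟩⟩

instance : One (HomothetyGroup R M) := ⟨⟨1, 0⟩⟩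

instance : Inv (HomothetyGroup R M) := ⟨fun a => ⟨a.lin⁻¹, -((a.lin⁻¹ : Rˣ) : R) • a.tr⟩⟩

theorem lin_mul (a b : HomothetyGroup R M) : (a * b).lin = a.lin * b.lin := rfl

theorem tr_mul (a b : HomothetyGroup R M) : (a * b).tr = a.tr + (a.lin : R) • b.tr := rfl

theorem lin_one : (1 : HomothetyGroup R M).lin = 1 := rfl

theorem tr_one : (1 : HomothetyGroup R M).tr = 0 := rfl

theorem lin_inv (a : HomothetyGroup R M) : a⁻¹.lin = a.lin⁻¹ := rfl

theorem tr_inv (a : HomothetyGroup R M) : a⁻¹.tr = -((a.lin⁻¹ : Rˣ) : R) • a.tr := rfl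

instance : Group (HomothetyGroup R M) :=
  Group.ofLeftAxioms
    (fun a b c => by
      ext1
      · simp only [lin_mul, mul_assoc]
      · simp only [tr_mul, lin_mul, Units.val_mul, smul_add, mul_smul, add_assoc])
    (fun a => by
      ext1
      · simp only [lin_mul, lin_one, one_mul]
      · simp only [tr_mul, lin_one, tr_one, Units.val_one, one_smul, zero_add])
    (fun a => by
      ext1
      · simp only [lin_mul, lin_inv, lin_one, inv_mul_cancel]
      · simp only [tr_mul, tr_inv, lin_inv, tr_one, neg_smul, neg_add_cancel])

/-- Linear parts commute, so commutators are translations, and translations commute with each other.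
-/
theorem comm (a b c d : HomothetyGroup R M) : Commute ⁅a, b⁆ ⁅c, d⁆ := by
  have h : ∀ a b : HomothetyGroup R M, ⁅a, b⁆.lin = 1 := fun a b => by
    rw [commutatorElement_def, lin_mul, lin_mul, lin_mul, lin_inv, lin_inv, mul_comm a.lin,
      mul_inv_cancel_right, mul_inv_cancel]
  ext1
  · rw [lin_mul, lin_mul, h, h]
  · rw [tr_mul, tr_mul, h, h, Units.val_one, one_smul, one_smul, add_comm]

end HomothetyGroup

/-- The integral Heisenberg group. -/
@[ext]
structure HeisenbergGroup where
  a : ℤ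
  b : ℤ
  c : ℤ

namespace HeisenbergGroup

instance : Mul HeisenbergGroup := ⟨fun p q => ⟨p.a + q.a, p.b + q.b, p.c + q.c + p.a * q.b⟩⟩

instance : One HeisenbergGroup := ⟨⟨0, 0, 0⟩⟩

instance : Inv HeisenbergGroup := ⟨fun p => ⟨-p.a, -p.b, -p.c + p.a * p.b⟩⟩

theorem mul_def (p q : HeisenbergGroup) :
    p * q = ⟨p.a + q.a, p.b + q.b, p.c + q.c + p.a * q.b⟩ := rfl

theorem one_def : (1 : HeisenbergGroup) = ⟨0, 0, 0⟩ := rfl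

theorem inv_def (p : HeisenbergGroup) : p⁻¹ = ⟨-p.a, -p.b, -p.c + p.a * p.b⟩ := rfl

instance : Group HeisenbergGroup :=
  Group.ofLeftAxioms
    (fun p q r => by ext <;> simp only [mul_def] <;> ring)
    (fun p => by ext <;> simp only [mul_def, one_def] <;> ring)
    (fun p => by ext <;> simp only [mul_def, one_def, inv_def] <;> ring)

theorem comm (p q r s : HeisenbergGroup) : Commute ⁅p, q⁆ ⁅r, s⁆ := by
  ext <;> simp only [commutatorElement_def, mul_def, inv_def] <;> ring

end HeisenbergGroup

/-- The ring of integral Laurent polynomials in `n` variables. -/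
abbrev LaurentRing (n : ℕ) : Type := AddMonoidAlgebra ℤ (Fin n → ℤ)

namespace LaurentRing

variable {n : ℕ}

/-- The monomial with the given exponents. -/
noncomputable def X (a : Fin n → ℤ) : LaurentRing n := AddMonoidAlgebra.single a 1

theorem X_zero : (X 0 : LaurentRing n) = 1 := rfl

theorem X_add (a b : Fin n → ℤ) : X (a + b) = X a * X b := by
  simp [X, AddMonoidAlgebra.single_mul_single]

theorem X_injective : Function.Injective (X : (Fin n → ℤ) → LaurentRing n) :=
  AddMonoidAlgebra.single_left_injective one_ne_zero

/-- The monomials as units. -/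
noncomputable def unitX (a : Fin n → ℤ) : (LaurentRing n)ˣ where
  val := X a
  inv := X (-a)
  val_inv := by rw [← X_add, add_neg_cancel, X_zero]
  inv_val := by rw [← X_add, neg_add_cancel, X_zero]

end LaurentRing

open LaurentRing

/-- The exponents and the free derivatives of the elements of a group generated by `x`. -/
structure MagnusData {G : Type w} [Group G] {n : ℕ} (x : Fin n → G) where
  k : G → Fin n → ℤ
  w : G → Fin n → LaurentRing n
  k_mul : ∀ g h, k (g * h) = k g + k h
  k_gen : ∀ i, k (x i) = Pi.single i 1
  w_mul : ∀ g h, w (g * h) = w g + X (k g) • w h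
  w_gen : ∀ i, w (x i) = Pi.single i 1

section

variable {G : Type w} [Group G] {n : ℕ} {x : Fin n → G}

theorem FreeMetabelianOn.induction_right (hx : FreeMetabelianOn x) {p : G → Prop} (one : p 1)
    (mul_gen : ∀ g i, p g → p (g * x i)) (mul_inv : ∀ g i, p g → p (g * (x i)⁻¹)) (g : G) : p g := by
  have hg : g ∈ Subgroup.closure (Set.range x) := hx.closure ▸ Subgroup.mem_top g
  induction hg using Subgroup.closure_induction_right with
  | one => exact one
  | mul_right g _ y hy ih =>
    obtain ⟨i, rfl⟩ := hy
    exact mul_gen g i ih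
  | mul_inv_cancel g _ y hy ih =>
    obtain ⟨i, rfl⟩ := hy
    exact mul_inv g i ih

/-- The exponents come from the map to the free abelian group. The derivatives are the translation
parts of the homomorphism sending x_i to the affine map with linear part X_i and translation e_i. -/
theorem FreeMetabelianOn.nonempty_magnusData (hx : FreeMetabelianOn x) :
    Nonempty (MagnusData x) := by
  obtain ⟨κ, hκ⟩ := hx.lift (H := Multiplicative (Fin n → ℤ)) (fun _ _ _ _ => mul_comm _ _)
    fun i => Multiplicative.ofAdd (Pi.single i 1)
  obtain ⟨φ, hφ⟩ := hx.lift (H := HomothetyGroup (LaurentRing n) (Fin n → LaurentRing n))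
    HomothetyGroup.comm fun i => ⟨unitX (Pi.single i 1), Pi.single i 1⟩
  -- Once the linear part of `φ g` is known to be the monomial with the exponents of `g`, the
  -- multiplication law of affine maps is the product rule for `w`.
  have hlin : ∀ g, ((φ g).lin : LaurentRing n) = X (κ g).toAdd := by
    refine hx.induction_right ?_ ?_ ?_
    · rw [map_one, map_one]
      rfl
    · intro g i hg
      rw [map_mul, map_mul, HomothetyGroup.lin_mul, Units.val_mul, hg, toAdd_mul, X_add, hφ, hκ]
      rfl
    · intro g i hg
      rw [map_mul, map_mul, HomothetyGroup.lin_mul, Units.val_mul, hg, toAdd_mul, X_add, map_inv,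
        map_inv, hφ, hκ]
      rfl
  refine ⟨⟨fun g => (κ g).toAdd, fun g => (φ g).tr, fun g h => ?_, fun i => ?_, fun g h => ?_,
    fun i => ?_⟩⟩
  · rw [map_mul, toAdd_mul]
  · rw [hκ, toAdd_ofAdd]
  · rw [map_mul, HomothetyGroup.tr_mul, hlin]
  · rw [hφ]

namespace MagnusData

variable (μ : MagnusData x)

theorem k_one : μ.k 1 = 0 := by simpa using μ.k_mul 1 1

theorem k_inv (g : G) : μ.k g⁻¹ = - μ.k g := by
  have := μ.k_mul g⁻¹ g
  rw [inv_mul_cancel, k_one] at this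
  exact eq_neg_of_add_eq_zero_left this.symm

theorem k_commutator (g h : G) : μ.k ⁅g, h⁆ = 0 := by
  rw [commutatorElement_def, μ.k_mul, μ.k_mul, μ.k_mul, k_inv, k_inv]
  abel

theorem k_conj (g h : G) : μ.k (g * h * g⁻¹) = μ.k h := by
  rw [μ.k_mul, μ.k_mul, k_inv]
  abel

theorem k_mul_inv_eq_zero {g h : G} : μ.k (g * h⁻¹) = 0 ↔ μ.k g = μ.k h := by
  rw [μ.k_mul, k_inv, ← sub_eq_add_neg, sub_eq_zero]

theorem k_zpow (g : G) (m : ℤ) : μ.k (g ^ m) = m • μ.k g := by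
  induction m using Int.induction_on with
  | zero => simp [k_one]
  | succ i ih => rw [zpow_add_one, μ.k_mul, ih, add_smul, one_smul]
  | pred i ih => rw [zpow_sub_one, μ.k_mul, ih, k_inv, sub_smul, one_smul, sub_eq_add_neg]

theorem w_one : μ.w 1 = 0 := by simpa [k_one, X_zero] using μ.w_mul 1 1

theorem w_inv (g : G) : μ.w g⁻¹ = - (X (- μ.k g) • μ.w g) := by
  have := μ.w_mul g⁻¹ g
  rw [inv_mul_cancel, w_one, k_inv] at this
  exact eq_neg_of_add_eq_zero_left this.symm

theorem w_mul_of_k {g h : G} (hg : μ.k g = 0) : μ.w (g * h) = μ.w g + μ.w h := by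
  rw [μ.w_mul, hg, X_zero, one_smul]

theorem w_inv_of_k {g : G} (hg : μ.k g = 0) : μ.w g⁻¹ = - μ.w g := by
  rw [w_inv, hg, neg_zero, X_zero, one_smul]

theorem w_conj {g h : G} (hh : μ.k h = 0) : μ.w (g * h * g⁻¹) = X (μ.k g) • μ.w h := by
  rw [μ.w_mul, μ.w_mul, μ.k_mul, hh, add_zero, w_inv, smul_neg, smul_smul, ← X_add,
    add_neg_cancel, X_zero, one_smul]
  abel

/-- On K, taking the commutator with `g` is multiplication by a scalar, nonzero as soon as `k g ≠
0`. In this form the module structure is visible to group-theoretic formulas. -/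
theorem w_commutator {u g : G} (hu : μ.k u = 0) : μ.w ⁅u, g⁆ = (1 - X (μ.k g)) • μ.w u := by
  have h : ⁅u, g⁆ = u * (g * u⁻¹ * g⁻¹) := by rw [commutatorElement_def]; group
  rw [h, μ.w_mul_of_k hu, w_conj μ (by rw [k_inv, hu, neg_zero]), w_inv_of_k μ hu, sub_smul,
    one_smul, smul_neg, sub_eq_add_neg]

theorem w_zpow {g : G} (hg : μ.k g = 0) (m : ℤ) : μ.w (g ^ m) = m • μ.w g := by
  have hm : ∀ m : ℤ, μ.k (g ^ m) = 0 := fun m => by rw [k_zpow, hg, smul_zero]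
  induction m using Int.induction_on with
  | zero => simp [w_one]
  | succ i ih => rw [zpow_add_one, μ.w_mul_of_k (hm _), ih, add_smul, one_smul]
  | pred i ih =>
    rw [zpow_sub_one, μ.w_mul_of_k (hm _), ih, μ.w_inv_of_k hg, sub_smul, one_smul, sub_eq_add_neg]

/-- The kernel of the abelianization. -/
def K : Subgroup G where
  carrier := {g | μ.k g = 0}
  mul_mem' {a b} ha hb := by
    rw [Set.mem_ofPred_eq] at *
    rw [μ.k_mul, ha, hb, add_zero]
  one_mem' := μ.k_one
  inv_mem' {a} ha := by
    rw [Set.mem_ofPred_eq] at *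
    rw [k_inv, ha, neg_zero]

theorem mem_K {g : G} : g ∈ μ.K ↔ μ.k g = 0 := Iff.rfl

variable (hx : FreeMetabelianOn x)

include hx

/-- Modulo this normal closure the generators commute, so the quotient is abelian and each element
is the product of the generators raised to its exponents. -/
theorem K_le_normalClosure :
    μ.K ≤ Subgroup.normalClosure {g | ∃ i j, g = ⁅x i, x j⁆} := by
  set N := Subgroup.normalClosure {g | ∃ i j, g = ⁅x i, x j⁆} with hN
  have hgen : ∀ i j, Commute (x i : G ⧸ N) (x j) := fun i j => by
    rw [← commutatorElement_eq_one_iff_commute]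
    have : ⁅x i, x j⁆ ∈ N := Subgroup.subset_normalClosure ⟨i, j, rfl⟩
    exact (QuotientGroup.eq_one_iff _).2 this
  have hcomm : ∀ a b : G ⧸ N, Commute a b := by
    have h1 : ∀ (g : G) (i : Fin n), Commute (g : G ⧸ N) (x i) := fun g i => by
      refine hx.induction_right (p := fun g => Commute (g : G ⧸ N) (x i)) ?_ ?_ ?_ g
      · exact Commute.one_left _
      · exact fun g j hg => hg.mul_left (hgen j i)
      · exact fun g j hg => hg.mul_left (hgen j i).inv_left
    rintro ⟨a⟩ ⟨b⟩
    refine hx.induction_right (p := fun b => Commute (a : G ⧸ N) (b : G ⧸ N)) ?_ ?_ ?_ b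
    · exact Commute.one_right _
    · exact fun g j hg => hg.mul_right (h1 a j)
    · exact fun g j hg => hg.mul_right (h1 a j).inv_right
  let : CommGroup (G ⧸ N) := { (inferInstance : Group (G ⧸ N)) with mul_comm := hcomm }
  have key : ∀ g : G, (g : G ⧸ N) = ∏ i, (x i : G ⧸ N) ^ μ.k g i := by
    refine hx.induction_right ?_ ?_ ?_
    · simp [k_one]
    · intro g i hg
      rw [QuotientGroup.mk_mul, hg, μ.k_mul, μ.k_gen]
      simp only [Pi.add_apply, zpow_add, Finset.prod_mul_distrib]
      congr 1
      rw [Finset.prod_eq_single i] <;> simp +contextual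
    · intro g i hg
      rw [QuotientGroup.mk_mul, hg, μ.k_mul, k_inv, μ.k_gen]
      simp only [Pi.add_apply, zpow_add, Finset.prod_mul_distrib]
      congr 1
      rw [Finset.prod_eq_single i] <;> simp +contextual
  intro g hg
  rw [mem_K] at hg
  rw [← QuotientGroup.eq_one_iff, key g, hg]
  simp

theorem commute_of_k_eq_zero {g h : G} (hg : μ.k g = 0) (hh : μ.k h = 0) : Commute g h := by
  have h1 : μ.K ≤ commutator G := by
    refine (μ.K_le_normalClosure hx).trans (Subgroup.normalClosure_le_normal ?_)
    rintro _ ⟨i, j, rfl⟩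
    exact Subgroup.commutator_mem_commutator (Subgroup.mem_top _) (Subgroup.mem_top _)
  have h2 : commutator G ≤ Subgroup.centralizer (commutator G : Set G) := by
    conv_lhs => rw [commutator_eq_closure]
    rw [Subgroup.closure_le]
    rintro _ ⟨a, b, rfl⟩
    rw [SetLike.mem_coe, commutator_eq_closure, Subgroup.centralizer_closure,
      Subgroup.mem_centralizer_iff]
    rintro _ ⟨c, d, rfl⟩
    exact hx.comm c d a b
  exact ((Subgroup.mem_centralizer_iff.1 (h2 (h1 hg))) h (h1 hh)).symm

/-- The Magnus embedding is injective. -/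
theorem eq_one_of_w_eq_zero {g : G} (hk : μ.k g = 0) (hw : μ.w g = 0) : g = 1 := by
  classical
  let : CommGroup μ.K := { (inferInstance : Group μ.K) with
    mul_comm := fun a b => Subtype.ext (μ.commute_of_k_eq_zero hx a.2 b.2) }
  -- `s` is a section of the exponent map; only its values at exponent vectors of actual elements
  -- matter.
  let s : (Fin n → ℤ) → G := fun a => if h : ∃ g, μ.k g = a then h.choose else 1
  have hs : ∀ g, μ.k (s (μ.k g)) = μ.k g := fun g => by
    have h : ∃ g', μ.k g' = μ.k g := ⟨g, rfl⟩
    simp only [s, dif_pos h]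
    exact h.choose_spec
  have hs0 : μ.k (s 0) = 0 := by
    have := hs 1
    rwa [k_one] at this
  -- These are the Schreier generators of K. The homomorphism `ρ` below sends the basis vector X^a
  -- e_i to `r a i`; it exists because K is abelian.
  let r : (Fin n → ℤ) → Fin n → μ.K := fun a i =>
    if h : μ.k (s a * x i * (s (a + Pi.single i 1))⁻¹) = 0 then ⟨_, h⟩ else 1
  let ρ : (Fin n → LaurentRing n) →+ Additive μ.K :=
    ∑ i, ((Finsupp.liftAddHom fun a =>
      zmultiplesHom (Additive μ.K) (Additive.ofMul (r a i))).comp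
        AddMonoidAlgebra.coeffAddEquiv.toAddMonoidHom).comp
          (Pi.evalAddMonoidHom (fun _ => LaurentRing n) i)
  have hρ : ∀ a i, ρ (X a • Pi.single i 1) = Additive.ofMul (r a i) := fun a i => by
    simp only [ρ, AddMonoidHom.finsetSum_apply, AddMonoidHom.comp_apply,
      Pi.evalAddMonoidHom_apply, Pi.smul_apply]
    rw [Finset.sum_eq_single i]
    · simp [X]
    · intro j _ hj
      simp [Pi.single_eq_of_ne hj]
    · simp
  -- `θ` obeys the same recursion along words as `ρ ∘ w`, so the two agree. On K it is conjugation
  -- by `s 0`, whence `w g = 0` forces `g = 1`.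
  let θ : G → μ.K := fun g => ⟨s 0 * g * (s (μ.k g))⁻¹, by
    rw [mem_K, μ.k_mul, μ.k_mul, k_inv, hs, hs0, zero_add, add_neg_cancel]⟩
  have hstep : ∀ g i, ρ (μ.w (g * x i)) = Additive.ofMul (θ (g * x i)) ↔
      ρ (μ.w g) = Additive.ofMul (θ g) := fun g i => by
    have h0 : μ.k (s (μ.k g) * x i * (s (μ.k g + Pi.single i 1))⁻¹) = 0 := by
      have := hs (g * x i)
      rw [μ.k_mul, μ.k_gen] at this
      rw [μ.k_mul, μ.k_mul, k_inv, this, hs, μ.k_gen, add_neg_cancel]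
    have h1 : θ (g * x i) = θ g * r (μ.k g) i := by
      simp only [r, dif_pos h0]
      apply Subtype.ext
      simp only [θ, Subgroup.coe_mul, μ.k_mul, μ.k_gen]
      group
    rw [μ.w_mul, map_add, μ.w_gen, hρ, h1, ofMul_mul, add_left_inj]
  have key : ∀ g, ρ (μ.w g) = Additive.ofMul (θ g) := by
    refine hx.induction_right ?_ (fun g i hg => (hstep g i).2 hg) fun g i hg => ?_
    · rw [w_one, map_zero]
      refine (ofMul_eq_zero.2 (Subtype.ext ?_)).symm
      simp only [θ, k_one, mul_one, mul_inv_cancel, Subgroup.coe_one]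
    · rw [← hstep, inv_mul_cancel_right, hg]
  have h := key g
  rw [hw, map_zero] at h
  have h2 := congrArg Subtype.val (ofMul_eq_zero.1 h.symm)
  simpa [θ, hk] using h2

theorem ext_of_k {g h : G} (hk : μ.k g = μ.k h) (hw : μ.w g = μ.w h) : g = h := by
  rw [← mul_inv_eq_one]
  refine μ.eq_one_of_w_eq_zero hx (μ.k_mul_inv_eq_zero.2 hk) ?_
  rw [μ.w_mul, w_inv, hk, smul_neg, smul_smul, ← X_add, add_neg_cancel, X_zero, one_smul, hw,
    add_neg_cancel]

/-- Map `G` to the Heisenberg group so that the first two coordinates read the exponents at `i` and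
`j`. Comparing the central coordinates of the two products gives the vanishing of the 2 × 2
determinant. -/
theorem k_mul_k_of_commute {g h : G} (hgh : Commute g h) (i j : Fin n) :
    μ.k g i * μ.k h j = μ.k h i * μ.k g j := by
  obtain ⟨φ, hφ⟩ := hx.lift (H := HeisenbergGroup) HeisenbergGroup.comm
    fun l => ⟨(Pi.single l 1 : Fin n → ℤ) i, (Pi.single l 1 : Fin n → ℤ) j, 0⟩
  have key : ∀ g, (φ g).a = μ.k g i ∧ (φ g).b = μ.k g j := by
    refine hx.induction_right ?_ ?_ ?_
    · rw [map_one, k_one]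
      exact ⟨rfl, rfl⟩
    · rintro g l ⟨h₁, h₂⟩
      rw [map_mul, HeisenbergGroup.mul_def, μ.k_mul, hφ, μ.k_gen]
      simp [h₁, h₂]
    · rintro g l ⟨h₁, h₂⟩
      rw [map_mul, map_inv, HeisenbergGroup.mul_def, HeisenbergGroup.inv_def, μ.k_mul, k_inv, hφ,
        μ.k_gen]
      simp [h₁, h₂]
  have h1 : φ g * φ h = φ h * φ g := by rw [← map_mul, hgh.eq, map_mul]
  have h2 := congrArg HeisenbergGroup.c h1
  simp only [HeisenbergGroup.mul_def, key] at h2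
  linarith

end MagnusData

end

/-! ### Divisibility and evaluation of Laurent polynomials -/

namespace LaurentRing

variable {n : ℕ}

theorem one_sub_X_ne_zero {a : Fin n → ℤ} (ha : a ≠ 0) : (1 - X a : LaurentRing n) ≠ 0 := by
  rw [sub_ne_zero, ← X_zero]
  exact fun h => ha (X_injective h).symm

theorem smul_right_cancel {f : LaurentRing n} (hf : f ≠ 0) {y z : Fin n → LaurentRing n}
    (h : f • y = f • z) : y = z :=
  funext fun i => mul_left_cancel₀ hf (congrFun h i)

/-- For positive `m`, `q` is the geometric sum 1 + X^a + ... + X^((m-1)a), whose terms are all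
congruent to 1 modulo 1 - X^a. The induction covers negative `m` as well. -/
theorem exists_geom_sum (a : Fin n → ℤ) (m : ℤ) : ∃ q s : LaurentRing n,
    1 - X (m • a) = (1 - X a) * q ∧ q = m + (1 - X a) * s := by
  induction m using Int.induction_on with
  | zero => exact ⟨0, 0, by simp [X_zero], by simp⟩
  | succ i ih =>
    obtain ⟨q, s, h₁, h₂⟩ := ih
    have h₃ : X ((i : ℤ) • a) = 1 - (1 - X a) * q := by rw [← h₁, sub_sub_cancel]
    refine ⟨q + X ((i : ℤ) • a), s - q, ?_, ?_⟩
    · rw [add_smul, one_smul, X_add, mul_add, ← h₁]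
      ring
    · rw [h₃]
      push_cast
      nth_rewrite 1 [h₂]
      push_cast
      ring
  | pred i ih =>
    obtain ⟨q, s, h₁, h₂⟩ := ih
    have h₃ : X ((-i : ℤ) • a) = 1 - (1 - X a) * q := by rw [← h₁, sub_sub_cancel]
    have h₄ : X a * X (-a) = 1 := by rw [← X_add, add_neg_cancel, X_zero]
    refine ⟨q - X ((-i : ℤ) • a) * X (-a), s - X (-a) + q + (1 - X a) * q * X (-a), ?_, ?_⟩
    · rw [show (-(i : ℤ) - 1) • a = (-(i : ℤ)) • a + -a by rw [sub_smul, one_smul, sub_eq_add_neg],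
        X_add, mul_sub, ← h₁]
      linear_combination - X ((-i : ℤ) • a) * h₄
    · rw [h₃]
      have h₂' : q - (((-i : ℤ) : LaurentRing n) + (1 - X a) * s) = 0 := sub_eq_zero.2 h₂
      push_cast at h₂' ⊢
      linear_combination h₂' - h₄ + q * (1 - X a) * h₄

theorem single_eq_smul_X (a : Fin n → ℤ) (c : ℤ) : AddMonoidAlgebra.single a c = c • X a := by
  simp [X]

theorem exists_diam_lt (s : Finset (Fin n → ℤ)) (i : Fin n) :
    ∃ p : ℤ, p ≠ 0 ∧ ∀ a ∈ s, ∀ b ∈ s, |a i - b i| < p := by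
  obtain ⟨M, hM⟩ := (s.image fun a => |a i|).exists_le
  refine ⟨2 * |M| + 1, by positivity, fun a ha b hb => ?_⟩
  have h₁ := hM _ (Finset.mem_image_of_mem _ ha)
  have h₂ := hM _ (Finset.mem_image_of_mem _ hb)
  have h₃ := abs_sub (a i) (b i)
  have h₄ := le_abs_self M
  linarith

/-- Take `p` larger than the width of the support of `f` in direction `i`. Reducing exponents modulo
`p` in that direction is then injective on the support, while it sends 1 - X_i^p, hence `f`, to
zero. -/
theorem eq_zero_of_forall_dvd (i : Fin n) {f : LaurentRing n}
    (h : ∀ p : ℤ, p ≠ 0 → (1 - X (p • Pi.single i 1)) ∣ f) : f = 0 := by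
  obtain ⟨p, hp0, hp⟩ : ∃ p : ℤ, p ≠ 0 ∧ ∀ a ∈ f.coeff.support, ∀ b ∈ f.coeff.support,
      |a i - b i| < p :=
    exists_diam_lt _ i
  obtain ⟨g, hg⟩ := h p hp0
  let N := AddSubgroup.zmultiples (p • Pi.single i 1 : Fin n → ℤ)
  let q := AddMonoidAlgebra.mapDomainRingHom ℤ (QuotientAddGroup.mk' N)
  have hq : q (X (p • Pi.single i 1)) = 1 := by
    have h1 : QuotientAddGroup.mk' N (p • Pi.single i 1) = 0 :=
      (QuotientAddGroup.eq_zero_iff _).2 (AddSubgroup.mem_zmultiples _)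
    change AddMonoidAlgebra.mapDomain _ _ = _
    rw [X, AddMonoidAlgebra.mapDomain_single, h1]
    rfl
  have h0 : q f = 0 := by rw [hg, map_mul, map_sub, map_one, hq, sub_self, zero_mul]
  have h1 : Finsupp.mapDomain (QuotientAddGroup.mk' N) f.coeff = 0 :=
    congrArg AddMonoidAlgebra.coeff h0
  have hinj : Set.InjOn (QuotientAddGroup.mk' N) (f.coeff.support : Set (Fin n → ℤ)) := by
    intro a ha b hb hab
    obtain ⟨m, hm⟩ := AddSubgroup.mem_zmultiples_iff.1 ((QuotientAddGroup.eq (s := N)).1 hab)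
    have h2 := hp a ha b hb
    have h3 := congrFun hm i
    simp only [Pi.smul_apply, Pi.single_eq_same, smul_eq_mul, mul_one, Pi.add_apply,
      Pi.neg_apply] at h3
    have hm0 : m = 0 := by
      by_contra hm0
      have h4 : |a i - b i| = |m| * |p| := by
        rw [← abs_mul, h3, abs_sub_comm]
        congr 1
        ring
      have h5 := Int.one_le_abs hm0
      have h6 := le_abs_self p
      nlinarith [abs_nonneg p]
    rw [hm0, zero_smul] at hm
    exact neg_add_eq_zero.1 hm.symm
  have h2 : f.coeff = 0 :=
    Finsupp.mapDomain_injOn (f.coeff.support : Set (Fin n → ℤ)) hinj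
      (show f.coeff ∈ {w : (Fin n → ℤ) →₀ ℤ | _} from fun _ h => h)
      (show (0 : (Fin n → ℤ) →₀ ℤ) ∈ {w : (Fin n → ℤ) →₀ ℤ | _} by simp) (by rw [h1]; simp)
  exact AddMonoidAlgebra.coeff_eq_zero.1 h2

theorem X_mem {S : Subring (LaurentRing n)} (h : ∀ i, X (Pi.single i 1) ∈ S)
    (h' : ∀ i, X (- Pi.single i 1) ∈ S) (a : Fin n → ℤ) : X a ∈ S := by
  have h1 : ∀ i (m : ℤ), X (m • Pi.single i 1) ∈ S := fun i m => by
    induction m using Int.induction_on with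
    | zero => simp [X_zero]
    | succ j ih =>
      rw [add_smul, one_smul, X_add]
      exact S.mul_mem ih (h i)
    | pred j ih =>
      rw [sub_smul, one_smul, sub_eq_add_neg, X_add]
      exact S.mul_mem ih (h' i)
  have h2 : ∀ s : Finset (Fin n), X (∑ i ∈ s, a i • Pi.single i 1) ∈ S := fun s => by
    induction s using Finset.cons_induction with
    | empty => simp [X_zero]
    | cons i s _ ih =>
      rw [Finset.sum_cons, X_add]
      exact S.mul_mem (h1 i _) ih
  have h3 := h2 Finset.univ
  rwa [← pi_eq_sum_univ' a] at h3

theorem subring_eq_top {S : Subring (LaurentRing n)} (h : ∀ i, X (Pi.single i 1) ∈ S)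
    (h' : ∀ i, X (- Pi.single i 1) ∈ S) (f : LaurentRing n) : f ∈ S := by
  induction f using AddMonoidAlgebra.induction_linear with
  | zero => exact S.zero_mem
  | add f g hf hg => exact S.add_mem hf hg
  | single a c =>
    rw [single_eq_smul_X]
    exact zsmul_mem (X_mem h h' a) c

/-- The value of the monomial with exponents `a` at the point with coordinates `2 ^ r i`. -/
noncomputable def char (a : Fin n → ℤ) : Multiplicative (Fin n → ℕ) →* ℚ where
  toFun r := 2 ^ (∑ i, a i * (r.toAdd i : ℤ))
  map_one' := by simp
  map_mul' r s := by
    rw [← zpow_add₀ two_ne_zero, ← Finset.sum_add_distrib]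
    simp [mul_add]

theorem char_apply (a : Fin n → ℤ) (r : Fin n → ℕ) :
    char a (Multiplicative.ofAdd r) = 2 ^ (∑ i, a i * (r i : ℤ)) := rfl

theorem char_injective : Function.Injective (char (n := n)) := by
  intro a b h
  funext i
  have := DFunLike.congr_fun h (Multiplicative.ofAdd (Pi.single i 1))
  rw [char_apply, char_apply] at this
  have h2 := zpow_right_injective₀ (a := (2 : ℚ)) (by norm_num) (by norm_num) this
  simpa [Pi.single_apply] using h2

/-- Evaluation of Laurent polynomials at the point with coordinates `2 ^ r i`. -/
noncomputable def evalTwoPow (r : Fin n → ℕ) : LaurentRing n →ₐ[ℤ] ℚ :=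
  AddMonoidAlgebra.lift ℤ ℚ (Fin n → ℤ)
    { toFun := fun a => char a.toAdd (Multiplicative.ofAdd r)
      map_one' := by simp [char_apply]
      map_mul' := fun a b => by
        rw [char_apply, char_apply, char_apply, ← zpow_add₀ two_ne_zero, ← Finset.sum_add_distrib]
        simp [add_mul] }

theorem evalTwoPow_X (r : Fin n → ℕ) (a : Fin n → ℤ) :
    evalTwoPow r (X a) = char a (Multiplicative.ofAdd r) := by
  rw [evalTwoPow, X, AddMonoidAlgebra.lift_single, one_smul]
  rfl

theorem evalTwoPow_X_single (r : Fin n → ℕ) (i : Fin n) :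
    evalTwoPow r (X (Pi.single i 1)) = 2 ^ r i := by
  rw [evalTwoPow_X, char_apply]
  simp [Pi.single_apply]

/-- As functions of `r`, the monomials are distinct characters of the monoid ℕⁿ, and Dedekind's
theorem makes them linearly independent. -/
theorem eq_zero_of_evalTwoPow {f : LaurentRing n} (h : ∀ r, evalTwoPow r f = 0) : f = 0 := by
  have hli := (linearIndependent_monoidHom (Multiplicative (Fin n → ℕ)) ℚ).comp char
    char_injective
  rw [linearIndependent_iff'] at hli
  have key := hli f.coeff.support (fun a => (f.coeff a : ℚ)) (by
    funext r
    have h1 := h r.toAdd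
    rw [evalTwoPow, AddMonoidAlgebra.lift_apply, Finsupp.sum] at h1
    simpa [Finset.sum_apply] using h1)
  refine AddMonoidAlgebra.coeff_eq_zero.1 (Finsupp.ext fun a => ?_)
  by_contra ha
  exact ha (by simpa using key a (Finsupp.mem_support_iff.2 ha))

/-- Modulo the ideal `J` of the X_i - 2^(r i), every Laurent polynomial becomes an integer after
clearing a denominator: the elements with this property form a subring containing all X_i and their
inverses. -/
theorem exists_smul_eq_intCast_add (r : Fin n → ℕ) (f : LaurentRing n) :
    ∃ D m : ℤ, D ≠ 0 ∧ ∃ h : Fin n → LaurentRing n,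
      D • f = m + ∑ i, (X (Pi.single i 1) - ((2 ^ r i : ℤ) : LaurentRing n)) * h i := by
  let J : Ideal (LaurentRing n) :=
    Ideal.span (Set.range fun i => X (Pi.single i 1) - ((2 ^ r i : ℤ) : LaurentRing n))
  let S : Subring (LaurentRing n) :=
    { carrier := {f | ∃ D m : ℤ, D ≠ 0 ∧ D * f - m ∈ J}
      mul_mem' := by
        rintro f g ⟨D, m, hD, hf⟩ ⟨D', m', hD', hg⟩
        refine ⟨D * D', m * m', mul_ne_zero hD hD', ?_⟩
        have := J.add_mem (J.mul_mem_left (D' * g) hf) (J.mul_mem_left (m : LaurentRing n) hg)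
        convert this using 1
        push_cast
        ring
      one_mem' := ⟨1, 1, one_ne_zero, by simp⟩
      add_mem' := by
        rintro f g ⟨D, m, hD, hf⟩ ⟨D', m', hD', hg⟩
        refine ⟨D * D', D' * m + D * m', mul_ne_zero hD hD', ?_⟩
        have := J.add_mem (J.mul_mem_left (D' : LaurentRing n) hf)
          (J.mul_mem_left (D : LaurentRing n) hg)
        convert this using 1
        push_cast
        ring
      zero_mem' := ⟨1, 0, one_ne_zero, by simp⟩
      neg_mem' := by
        rintro f ⟨D, m, hD, hf⟩
        refine ⟨D, -m, hD, ?_⟩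
        have := J.neg_mem hf
        convert this using 1
        push_cast
        ring }
  have hgen : ∀ i, X (Pi.single i 1) - ((2 ^ r i : ℤ) : LaurentRing n) ∈ J := fun i =>
    Ideal.subset_span ⟨i, rfl⟩
  have hf : f ∈ S := by
    refine subring_eq_top (fun i => ?_) (fun i => ?_) f
    · exact ⟨1, 2 ^ r i, one_ne_zero, by simpa using hgen i⟩
    -- The product of 2^(r i) and the inverse of X_i is 1 modulo `J`; inverse variables are what
    -- makes denominators necessary.
    · refine ⟨2 ^ r i, 1, by positivity, ?_⟩
      have := J.neg_mem (J.mul_mem_left (X (- Pi.single i 1)) (hgen i))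
      have h2 : X (- Pi.single i 1) * X (Pi.single i 1) = (1 : LaurentRing n) := by
        rw [← X_add, neg_add_cancel, X_zero]
      convert this using 1
      rw [mul_sub, h2]
      push_cast
      ring
  obtain ⟨D, m, hD, h⟩ := hf
  obtain ⟨c, hc⟩ := Ideal.mem_span_range_iff_exists_fun.1 h
  refine ⟨D, m, hD, c, ?_⟩
  rw [zsmul_eq_mul, ← sub_eq_iff_eq_add', ← hc]
  exact Finset.sum_congr rfl fun i _ => mul_comm _ _

end LaurentRing

/-! ### The module of the commutator subgroup and its separating relations -/

section

variable {G : Type w} [Group G] {n : ℕ} {x : Fin n → G}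

namespace MagnusData

variable (μ : MagnusData x)

theorem exists_k_eq (a : Fin n → ℤ) : ∃ g, μ.k g = a := by
  have h : ∀ s : Finset (Fin n), ∃ g, μ.k g = ∑ i ∈ s, a i • Pi.single i 1 := fun s => by
    induction s using Finset.cons_induction with
    | empty => exact ⟨1, by simpa using μ.k_one⟩
    | cons i s _ ih =>
      obtain ⟨g, hg⟩ := ih
      refine ⟨x i ^ a i * g, ?_⟩
      rw [μ.k_mul, k_zpow, μ.k_gen, hg, Finset.sum_cons]
  obtain ⟨g, hg⟩ := h Finset.univ
  exact ⟨g, hg.trans (pi_eq_sum_univ' a).symm⟩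

/-- The image of the commutator subgroup under the Magnus embedding. -/
def W : Submodule (LaurentRing n) (Fin n → LaurentRing n) where
  carrier := {y | ∃ u, μ.k u = 0 ∧ μ.w u = y}
  zero_mem' := ⟨1, μ.k_one, μ.w_one⟩
  add_mem' := by
    rintro _ _ ⟨u, hu, rfl⟩ ⟨v, hv, rfl⟩
    exact ⟨u * v, by rw [μ.k_mul, hu, hv, add_zero], μ.w_mul_of_k hu⟩
  smul_mem' := by
    intro f y hy
    induction f using AddMonoidAlgebra.induction_linear with
    | zero => exact ⟨1, μ.k_one, by rw [μ.w_one, zero_smul]⟩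
    | add f g hf hg =>
      obtain ⟨u, hu, hu'⟩ := hf
      obtain ⟨v, hv, hv'⟩ := hg
      exact ⟨u * v, by rw [μ.k_mul, hu, hv, add_zero],
        by rw [μ.w_mul_of_k hu, hu', hv', add_smul]⟩
    | single a c =>
      obtain ⟨u, hu, rfl⟩ := hy
      obtain ⟨g, rfl⟩ := μ.exists_k_eq a
      have h : μ.k (g * u * g⁻¹) = 0 := by rw [k_conj, hu]
      refine ⟨(g * u * g⁻¹) ^ c, by rw [k_zpow, h, smul_zero], ?_⟩
      rw [μ.w_zpow h, μ.w_conj hu, single_eq_smul_X, smul_assoc]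

theorem w_mem_W {u : G} (hu : μ.k u = 0) : μ.w u ∈ μ.W := ⟨u, hu, rfl⟩

/-- The elements of K with image in the span form a normal subgroup, because conjugation acts by
monomials, and it contains the commutators of generators. -/
theorem W_le_span (hx : FreeMetabelianOn x) : μ.W ≤ Submodule.span (LaurentRing n)
    (Set.range fun p : Fin n × Fin n => μ.w ⁅x p.1, x p.2⁆) := by
  set E := Submodule.span (LaurentRing n) (Set.range fun p : Fin n × Fin n => μ.w ⁅x p.1, x p.2⁆)
  let N : Subgroup G :=
    { carrier := {u | μ.k u = 0 ∧ μ.w u ∈ E}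
      one_mem' := ⟨μ.k_one, by rw [μ.w_one]; exact E.zero_mem⟩
      mul_mem' := by
        rintro u v ⟨hu, hu'⟩ ⟨hv, hv'⟩
        exact ⟨by rw [μ.k_mul, hu, hv, add_zero], by rw [μ.w_mul_of_k hu]; exact E.add_mem hu' hv'⟩
      inv_mem' := by
        rintro u ⟨hu, hu'⟩
        exact ⟨by rw [k_inv, hu, neg_zero], by rw [μ.w_inv_of_k hu]; exact E.neg_mem hu'⟩ }
  have hN : N.Normal := ⟨by
    rintro u ⟨hu, hu'⟩ g
    exact ⟨by rw [k_conj, hu], by rw [μ.w_conj hu]; exact E.smul_mem _ hu'⟩⟩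
  rintro _ ⟨u, hu, rfl⟩
  refine (((μ.K_le_normalClosure hx).trans (Subgroup.normalClosure_le_normal ?_) :
    μ.K ≤ N) hu).2
  rintro _ ⟨i, j, rfl⟩
  exact ⟨μ.k_commutator _ _, Submodule.subset_span ⟨(i, j), rfl⟩⟩

/-- A relation between elements of `W` and tuples of integers which separates the elements. -/
def Sep (y : Fin n → LaurentRing n) (N : Fin n → ℤ) (D : ℤ) (m : Fin n × Fin n → ℤ) : Prop :=
  D ≠ 0 ∧ ∃ d : Fin n → Fin n → LaurentRing n, (∀ i, d i ∈ μ.W) ∧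
    D • y = ∑ p, m p • μ.w ⁅x p.1, x p.2⁆ + ∑ i, (X (Pi.single i 1) • d i - N i • d i)

/-- Write `y` as a combination of the w ⁅x i, x j⁆ and replace each coefficient by an integer modulo
the ideal of the point. The product of the denominators serves as `D`. -/
theorem exists_sep (hx : FreeMetabelianOn x) {y : Fin n → LaurentRing n} (hy : y ∈ μ.W)
    (r : Fin n → ℕ) : ∃ D m, μ.Sep y (fun i => 2 ^ r i) D m := by
  obtain ⟨c, rfl⟩ := (Submodule.mem_span_range_iff_exists_fun _).1 (μ.W_le_span hx hy)
  choose D m hD h e using fun p => exists_smul_eq_intCast_add r (c p)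
  refine ⟨∏ p, D p, fun p => (∏ q ∈ Finset.univ.erase p, D q) * m p,
    Finset.prod_ne_zero_iff.2 fun p _ => hD p,
    fun i => ∑ p, ((∏ q ∈ Finset.univ.erase p, D q) • h p i) • μ.w ⁅x p.1, x p.2⁆,
    fun i => Submodule.sum_mem _ fun p _ => μ.W.smul_mem _ (μ.w_mem_W (μ.k_commutator _ _)), ?_⟩
  have h1 : ∀ p, (∏ q, D q) • (c p • μ.w ⁅x p.1, x p.2⁆) =
      ((∏ q ∈ Finset.univ.erase p, D q) * m p) • μ.w ⁅x p.1, x p.2⁆ +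
      ∑ i, (X (Pi.single i 1) - ((2 ^ r i : ℤ) : LaurentRing n)) •
        (((∏ q ∈ Finset.univ.erase p, D q) • h p i) • μ.w ⁅x p.1, x p.2⁆) := fun p => by
    rw [← Finset.prod_erase_mul _ _ (Finset.mem_univ p), mul_smul, ← smul_assoc (D p), e p,
      add_smul, smul_add, mul_smul, Finset.sum_smul, Finset.smul_sum, Int.cast_smul_eq_zsmul]
    congr 1
    refine Finset.sum_congr rfl fun i _ => ?_
    rw [smul_smul, ← smul_assoc, mul_smul_comm]
  rw [Finset.smul_sum, Finset.sum_congr rfl fun p _ => h1 p, Finset.sum_add_distrib,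
    Finset.sum_comm]
  congr 1
  refine Finset.sum_congr rfl fun i _ => ?_
  rw [← Finset.smul_sum, sub_smul, Int.cast_smul_eq_zsmul]

/-- Evaluation at the point kills the terms with `d`, so `D` and `m` determine the value of the
vector there. -/
theorem evalTwoPow_eq_of_sep {y z : Fin n → LaurentRing n} {r : Fin n → ℕ} {D : ℤ}
    {m : Fin n × Fin n → ℤ} (hy : μ.Sep y (fun i => 2 ^ r i) D m)
    (hz : μ.Sep z (fun i => 2 ^ r i) D m) (l : Fin n) :
    evalTwoPow r (y l) = evalTwoPow r (z l) := by
  obtain ⟨hD, d, -, hd⟩ := hy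
  obtain ⟨-, d', -, hd'⟩ := hz
  have key : ∀ {y : Fin n → LaurentRing n} {d : Fin n → Fin n → LaurentRing n},
      D • y = ∑ p, m p • μ.w ⁅x p.1, x p.2⁆ +
        ∑ i, (X (Pi.single i 1) • d i - (2 ^ r i : ℤ) • d i) →
      (D : ℚ) * evalTwoPow r (y l) = evalTwoPow r ((∑ p, m p • μ.w ⁅x p.1, x p.2⁆) l) := by
    intro y d h
    have h1 := congrArg (fun y => evalTwoPow r (y l)) h
    simp only [Pi.smul_apply, Pi.add_apply, map_add, Finset.sum_apply, Pi.sub_apply, map_sum,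
      map_sub, smul_eq_mul, map_mul, evalTwoPow_X_single, map_zsmul] at h1
    rw [zsmul_eq_mul] at h1
    rw [h1, Finset.sum_apply, map_sum]
    simp
  have := (key hd).trans (key hd').symm
  exact mul_left_cancel₀ (Int.cast_ne_zero.2 hD) this

/-- Only the tuples `N` of powers of two are used. Allowing all `N` spares a definition of powers of
two and only strengthens the hypothesis. -/
theorem eq_of_sep (hx : FreeMetabelianOn x) {y z : Fin n → LaurentRing n} (hy : y ∈ μ.W)
    (h : ∀ N D m, μ.Sep y N D m → μ.Sep z N D m) : y = z := by
  funext l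
  rw [← sub_eq_zero]
  refine eq_zero_of_evalTwoPow fun r => ?_
  obtain ⟨D, m, hD⟩ := μ.exists_sep hx hy r
  rw [map_sub, μ.evalTwoPow_eq_of_sep hD (h _ _ _ hD), sub_self]

end MagnusData

end

/-! ### The integers inside the group -/

open Calc

section

variable {G : Type w} [Group G] {n : ℕ}

theorem FreeMetabelianOn.definable_const {x : Fin n → G} (hx : FreeMetabelianOn x) (g : G) :
    (Set.range x).Definable Language.groups {y : Unit → G | y () = g} := by
  have key : ∃ t : Language.groups.Term (Set.range x ⊕ Unit), ∀ v : Unit → G,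
      t.realize (Sum.elim (fun a : Set.range x => (a : G)) v) = g := by
    have hg : g ∈ Subgroup.closure (Set.range x) := hx.closure ▸ Subgroup.mem_top g
    induction hg using Subgroup.closure_induction with
    | mem g hg => exact ⟨.var (Sum.inl ⟨g, hg⟩), fun v => rfl⟩
    | one => exact ⟨.func GroupFunc.one ![], fun v => rfl⟩
    | mul _ _ _ _ h₁ h₂ =>
      obtain ⟨t₁, h₁⟩ := h₁
      obtain ⟨t₂, h₂⟩ := h₂
      refine ⟨.func GroupFunc.mul ![t₁, t₂], fun v => ?_⟩
      rw [← h₁ v, ← h₂ v]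
      rfl
    | inv _ _ h =>
      obtain ⟨t, h⟩ := h
      refine ⟨.func GroupFunc.inv ![t], fun v => ?_⟩
      rw [← h v]
      rfl
  obtain ⟨t, ht⟩ := key
  refine Set.definable_iff_exists_formula_sum.2 ⟨Term.equal (.var (Sum.inr ())) t, ?_⟩
  ext y
  simp [Formula.realize_equal, ht]

/-- The calculus of the subsets of powers of `G` that are definable with the generators as
parameters. -/
def groupCalc {x : Fin n → G} (hx : FreeMetabelianOn x) : Calc G :=
  Calc.ofDefinable Language.groups (Set.range x) hx.definable_const

/-- The Magnus embedding. -/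
noncomputable def FreeMetabelianOn.magnus {x : Fin n → G} (hx : FreeMetabelianOn x) :
    MagnusData x := hx.nonempty_magnusData.some

section operations

variable {x : Fin n → G} {hx : FreeMetabelianOn x} {Y : Type*} [Rep (groupCalc hx) Y]

theorem dfun_funMap_group {m : ℕ} (f : Language.groups.Functions m) :
    (groupCalc hx).DFun (fun y : Fin m → G => Structure.funMap f y) :=
  DFun.funMap Language.groups _ hx.definable_const f

@[fun_prop]
theorem DFun.group_mul {f g : Y → G} (hf : (groupCalc hx).DFun f) (hg : (groupCalc hx).DFun g) :
    (groupCalc hx).DFun (fun y => f y * g y) :=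
  (dfun_funMap_group GroupFunc.mul).comp (f := fun y => ![f y, g y])
    (DFun.pi fun i => by fin_cases i <;> assumption)

@[fun_prop]
theorem DFun.group_inv {f : Y → G} (hf : (groupCalc hx).DFun f) :
    (groupCalc hx).DFun (fun y => (f y)⁻¹) :=
  (dfun_funMap_group GroupFunc.inv).comp (f := fun y => ![f y])
    (DFun.pi fun i => by fin_cases i; assumption)

@[fun_prop]
theorem DFun.group_commutator {f g : Y → G} (hf : (groupCalc hx).DFun f)
    (hg : (groupCalc hx).DFun g) : (groupCalc hx).DFun (fun y => ⁅f y, g y⁆) := by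
  simp only [commutatorElement_def]
  fun_prop

theorem DFun.group_list_prod {ι : Type*} {f : Y → ι → G}
    (hf : ∀ i, (groupCalc hx).DFun (fun y => f y i)) (l : List ι) :
    (groupCalc hx).DFun (fun y => (l.map (f y)).prod) := by
  induction l with
  | nil => simpa using DFun.const 1
  | cons i l ih =>
    simp only [List.map_cons, List.prod_cons]
    fun_prop

end operations

namespace FreeMetabelianOn

variable {x : Fin (n + 2) → G} (hx : FreeMetabelianOn x)

/-- The elements with zero exponents. -/
def InK (g : G) : Prop := hx.magnus.k g = 0

/-- The elements whose exponents vanish except perhaps at one place, where it is `m`. -/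
def OnAxis (i : Fin (n + 2)) (g : G) (m : ℤ) : Prop := hx.magnus.k g = m • Pi.single i 1

theorem onAxis_zpow (i : Fin (n + 2)) (m : ℤ) : hx.OnAxis i (x i ^ m) m := by
  rw [OnAxis, MagnusData.k_zpow, hx.magnus.k_gen]

theorem OnAxis.mul {hx : FreeMetabelianOn x} {i : Fin (n + 2)} {g h : G} {a b : ℤ}
    (hg : hx.OnAxis i g a) (hh : hx.OnAxis i h b) : hx.OnAxis i (g * h) (a + b) := by
  rw [OnAxis] at *
  rw [hx.magnus.k_mul, hg, hh, add_smul]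

theorem OnAxis.inv {hx : FreeMetabelianOn x} {i : Fin (n + 2)} {g : G} {a : ℤ}
    (hg : hx.OnAxis i g a) : hx.OnAxis i g⁻¹ (-a) := by
  rw [OnAxis] at *
  rw [MagnusData.k_inv, hg, neg_smul]

theorem OnAxis.eq {hx : FreeMetabelianOn x} {i : Fin (n + 2)} {g : G} {a b : ℤ}
    (ha : hx.OnAxis i g a) (hb : hx.OnAxis i g b) : a = b := by
  rw [OnAxis] at *
  have := congrFun (ha.symm.trans hb) i
  simpa using this

theorem OnAxis.of_inK {hx : FreeMetabelianOn x} {i : Fin (n + 2)} {g h : G} {a : ℤ}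
    (ha : hx.OnAxis i h a) (hg : hx.InK (g * h⁻¹)) : hx.OnAxis i g a := by
  rw [OnAxis] at *
  rw [← ha]
  exact (hx.magnus.k_mul_inv_eq_zero).1 hg

theorem OnAxis.inK {hx : FreeMetabelianOn x} {i : Fin (n + 2)} {g h : G} {a : ℤ}
    (hg : hx.OnAxis i g a) (hh : hx.OnAxis i h a) : hx.InK (g * h⁻¹) :=
  (hx.magnus.k_mul_inv_eq_zero).2 (hg.trans hh.symm)

/-- Otherwise x 0 and x 1 would commute, although their exponent vectors are not proportional. This
needs two generators. -/
theorem w_commutator_ne_zero : hx.magnus.w ⁅x 0, x 1⁆ ≠ 0 := by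
  intro h
  have h1 := hx.magnus.eq_one_of_w_eq_zero hx (hx.magnus.k_commutator _ _) h
  have h2 := hx.magnus.k_mul_k_of_commute hx (commutatorElement_eq_one_iff_commute.1 h1) 0 1
  simp [hx.magnus.k_gen] at h2

theorem smul_w_commutator_injective {f g : LaurentRing (n + 2)}
    (h : f • hx.magnus.w ⁅x 0, x 1⁆ = g • hx.magnus.w ⁅x 0, x 1⁆) : f = g := by
  obtain ⟨i, hi⟩ := Function.ne_iff.1 hx.w_commutator_ne_zero
  exact mul_right_cancel₀ hi (congrFun h i)

/-- Conjugation multiplies the nonzero vector of ⁅x 0, x 1⁆ by a monomial, which can be recovered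
because the Laurent ring is a domain. -/
theorem k_eq_of_conj {g h : G} (e : g * ⁅x 0, x 1⁆ * g⁻¹ = h * ⁅x 0, x 1⁆ * h⁻¹) :
    hx.magnus.k g = hx.magnus.k h := by
  have h1 := congrArg hx.magnus.w e
  rw [hx.magnus.w_conj (hx.magnus.k_commutator _ _),
    hx.magnus.w_conj (hx.magnus.k_commutator _ _)] at h1
  exact X_injective (hx.smul_w_commutator_injective h1)

/-- K is abelian, and an element centralizing ⁅x 0, x 1⁆ conjugates it as the unit does, so it has
the exponents of the unit. -/
theorem inK_iff (g : G) : hx.InK g ↔ g * ⁅x 0, x 1⁆ = ⁅x 0, x 1⁆ * g := by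
  constructor
  · intro h
    exact (hx.magnus.commute_of_k_eq_zero hx h (hx.magnus.k_commutator _ _)).eq
  · intro h
    rw [InK, ← hx.magnus.k_one]
    refine hx.k_eq_of_conj ?_
    rw [h]
    group

/-- Elements commuting with x i have exponents proportional to those of x i, so its centralizer maps
onto the axis modulo K. -/
theorem exists_onAxis_iff (i : Fin (n + 2)) (g : G) :
    (∃ m, hx.OnAxis i g m) ↔ ∃ h, h * x i = x i * h ∧ hx.InK (g * h⁻¹) := by
  constructor
  · rintro ⟨m, hm⟩
    exact ⟨x i ^ m, (Commute.refl (x i)).zpow_left m, hm.inK (hx.onAxis_zpow i m)⟩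
  · rintro ⟨h, hc, hK⟩
    refine ⟨hx.magnus.k h i, OnAxis.of_inK ?_ hK⟩
    rw [OnAxis]
    funext j
    have := hx.magnus.k_mul_k_of_commute hx hc j i
    rw [hx.magnus.k_gen] at this
    simpa [mul_comm] using this

/-- The quotient of the two elements lies in K and commutes with x 0, so its vector is killed by 1 -
X_0 and vanishes. -/
theorem eq_of_commutator_eq {g h : G} (hk : hx.magnus.k g = hx.magnus.k h)
    (e : ⁅g, x 0⁆ = ⁅h, x 0⁆) : g = h := by
  have h0 : hx.magnus.k (h⁻¹ * g) = 0 := by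
    rw [hx.magnus.k_mul, MagnusData.k_inv, hk, neg_add_cancel]
  have h1 : ⁅h⁻¹ * g, x 0⁆ = 1 := by
    rw [commutatorElement_eq_one_iff_mul_comm]
    rw [commutatorElement_def, commutatorElement_def, mul_left_inj, ← eq_mul_inv_iff_mul_eq,
      inv_inv] at e
    rw [mul_assoc, e]
    group
  have h2 := hx.magnus.w_commutator (g := x 0) h0
  rw [h1, MagnusData.w_one, hx.magnus.k_gen] at h2
  have h3 : (1 - X (Pi.single 0 1) : LaurentRing (n + 2)) ≠ 0 :=
    one_sub_X_ne_zero fun h => one_ne_zero (Pi.single_eq_zero_iff.1 h)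
  have h4 : hx.magnus.w (h⁻¹ * g) = 0 :=
    smul_right_cancel h3 (by rw [← h2, smul_zero])
  exact (inv_mul_eq_one.1 (hx.magnus.eq_one_of_w_eq_zero hx h0 h4)).symm

variable [Nontrivial G] {Y : Type*} [Rep (groupCalc hx) Y]

@[fun_prop]
theorem dfun_inK {f : Y → G} (hf : (groupCalc hx).DFun f) :
    (groupCalc hx).DFun (fun y => hx.InK (f y)) := by
  simp only [inK_iff]
  fun_prop

open Classical in
/-- An element is replaced by the unit if it does not lie on the first axis. -/
noncomputable def axisPart (g : G) : G :=
  if ∃ h, h * x 0 = x 0 * h ∧ hx.InK (g * h⁻¹) then g else 1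

@[fun_prop]
theorem dfun_axisPart {f : Y → G} (hf : (groupCalc hx).DFun f) :
    (groupCalc hx).DFun (fun y => hx.axisPart (f y)) := by
  unfold axisPart
  fun_prop

/-- The map of `G` onto `ℤ`: the exponent of the first generator on the first axis. -/
noncomputable def toInt (g : G) : ℤ := hx.magnus.k (hx.axisPart g) 0

omit [Nontrivial G] in
theorem onAxis_axisPart (g : G) : hx.OnAxis 0 (hx.axisPart g) (hx.toInt g) := by
  obtain ⟨m, hm⟩ : ∃ m, hx.OnAxis 0 (hx.axisPart g) m := by
    by_cases h : ∃ h, h * x 0 = x 0 * h ∧ hx.InK (g * h⁻¹)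
    · rw [axisPart, if_pos h]
      exact (hx.exists_onAxis_iff 0 g).2 h
    · rw [axisPart, if_neg h]
      exact ⟨0, by rw [OnAxis, MagnusData.k_one, zero_smul]⟩
  have : hx.toInt g = m := by
    rw [toInt, hm]
    simp
  rwa [this]

omit [Nontrivial G] in
theorem toInt_eq {g : G} {m : ℤ} (h : hx.OnAxis 0 g m) : hx.toInt g = m := by
  have h1 := (hx.exists_onAxis_iff 0 g).1 ⟨m, h⟩
  have h2 := hx.onAxis_axisPart g
  rw [axisPart, if_pos h1] at h2
  exact h2.eq h

omit [Nontrivial G] in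
theorem toInt_zpow (m : ℤ) : hx.toInt (x 0 ^ m) = m := hx.toInt_eq (hx.onAxis_zpow 0 m)

omit [Nontrivial G] in
theorem toInt_eq_toInt_iff (g h : G) :
    hx.toInt g = hx.toInt h ↔ hx.InK (hx.axisPart g * (hx.axisPart h)⁻¹) := by
  constructor
  · intro e
    have := hx.onAxis_axisPart g
    rw [e] at this
    exact this.inK (hx.onAxis_axisPart h)
  · intro e
    exact (hx.onAxis_axisPart g).eq ((hx.onAxis_axisPart h).of_inK e)

/-- The integers as a sort of `G`. -/
noncomputable instance instIntSort : Rep (groupCalc hx) ℤ where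
  ι := Unit
  fin := inferInstance
  π y := hx.toInt (y ())
  surj m := ⟨fun _ => x 0 ^ m, hx.toInt_zpow m⟩
  ker := by
    have : (groupCalc hx).DFun (fun y : Unit ⊕ Unit → G =>
        hx.InK (hx.axisPart (y (Sum.inl ())) * (hx.axisPart (y (Sum.inr ())))⁻¹)) := by fun_prop
    exact (dfun_base_prop_iff.1 this).of_eq fun y => hx.toInt_eq_toInt_iff _ _

theorem dfun_toInt' : (groupCalc hx).DFun hx.toInt := Rep.ker (𝒟 := groupCalc hx) (X := ℤ)

@[fun_prop]
theorem dfun_toInt {f : Y → G} (hf : (groupCalc hx).DFun f) :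
    (groupCalc hx).DFun (fun y => hx.toInt (f y)) := hx.dfun_toInt'.comp hf

omit [Nontrivial G] in
theorem onAxis_zero_iff (g : G) (m : ℤ) :
    hx.OnAxis 0 g m ↔ ∃ h, hx.toInt h = m ∧ hx.InK (g * (hx.axisPart h)⁻¹) := by
  constructor
  · intro h
    refine ⟨x 0 ^ m, hx.toInt_zpow m, h.inK ?_⟩
    have := hx.onAxis_axisPart (x 0 ^ m)
    rwa [hx.toInt_zpow] at this
  · rintro ⟨h, rfl, e⟩
    exact (hx.onAxis_axisPart h).of_inK e

@[fun_prop]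
theorem dfun_onAxis_zero {f : Y → G} {m : Y → ℤ} (hf : (groupCalc hx).DFun f)
    (hm : (groupCalc hx).DFun m) : (groupCalc hx).DFun (fun y => hx.OnAxis 0 (f y) (m y)) := by
  simp only [onAxis_zero_iff]
  fun_prop

@[fun_prop]
theorem dfun_add {f g : Y → ℤ} (hf : (groupCalc hx).DFun f) (hg : (groupCalc hx).DFun g) :
    (groupCalc hx).DFun (fun y => f y + g y) := by
  refine DFun.comp (g := fun p : ℤ × ℤ => p.1 + p.2) (DFun.of_graph ?_) (hf.prodMk hg)
  have : (groupCalc hx).DFun (fun p : (ℤ × ℤ) × ℤ => ∃ g h : G,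
    hx.OnAxis 0 g p.1.1 ∧ hx.OnAxis 0 h p.1.2 ∧ hx.OnAxis 0 (g * h) p.2) := by fun_prop
  convert this using 2 with p
  constructor
  · intro e
    exact ⟨_, _, hx.onAxis_zpow 0 _, hx.onAxis_zpow 0 _,
      e ▸ (hx.onAxis_zpow 0 _).mul (hx.onAxis_zpow 0 _)⟩
  · rintro ⟨g, h, hg, hh, e⟩
    exact (hg.mul hh).eq e

@[fun_prop]
theorem dfun_neg {f : Y → ℤ} (hf : (groupCalc hx).DFun f) :
    (groupCalc hx).DFun (fun y => - f y) := by
  refine DFun.comp (g := fun p : ℤ => - p) (DFun.of_graph ?_) hf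
  have : (groupCalc hx).DFun (fun p : ℤ × ℤ => ∃ g : G,
    hx.OnAxis 0 g p.1 ∧ hx.OnAxis 0 g⁻¹ p.2) := by fun_prop
  convert this using 2 with p
  constructor
  · intro e
    exact ⟨_, hx.onAxis_zpow 0 _, e ▸ (hx.onAxis_zpow 0 _).inv⟩
  · rintro ⟨g, hg, e⟩
    exact hg.inv.eq e

omit [Nontrivial G] in
/-- Powers of an element of the form `x₀ ^ a * x₁` up to elements of `K`. -/
theorem exists_commute_iff {g z y : G} {a b c : ℤ} (hg : hx.OnAxis 0 g a) (hz : hx.OnAxis 0 z b)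
    (hy : hx.OnAxis 1 y c) :
    (∃ h, h * (g * x 1) = (g * x 1) * h ∧ hx.InK (z * y * h⁻¹)) ↔ b = a * c := by
  rw [OnAxis] at hg hz hy
  constructor
  · rintro ⟨h, hc, hK⟩
    have h1 := (hx.magnus.k_mul_inv_eq_zero).1 hK
    -- Proportionality of (b, c) to (a, 1) is the equation b = a * c, which is how multiplication
    -- becomes definable.
    have h2 := hx.magnus.k_mul_k_of_commute hx hc 0 1
    rw [← h1, hx.magnus.k_mul, hx.magnus.k_mul, hg, hz, hy, hx.magnus.k_gen] at h2
    simpa using h2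
  · intro e
    refine ⟨(g * x 1) ^ c, (Commute.refl (g * x 1)).zpow_left c,
      (hx.magnus.k_mul_inv_eq_zero).2 ?_⟩
    rw [MagnusData.k_zpow, hx.magnus.k_mul, hx.magnus.k_mul, hg, hz, hy, hx.magnus.k_gen, e,
      smul_add, smul_smul, mul_comm]

omit [Nontrivial G] in
-- The case `a = 1` of `exists_commute_iff` transports integers from the first axis to the second
-- along the diagonal.
theorem onAxis_one_iff (g : G) (m : ℤ) : hx.OnAxis 1 g m ↔
    (∃ h, h * x 1 = x 1 * h ∧ hx.InK (g * h⁻¹)) ∧ ∃ y, hx.OnAxis 0 y m ∧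
      ∃ h, h * (x 0 * x 1) = (x 0 * x 1) * h ∧ hx.InK (y * g * h⁻¹) := by
  have h0 : hx.OnAxis 0 (x 0) 1 := by simpa using hx.onAxis_zpow 0 1
  constructor
  · intro h
    exact ⟨(hx.exists_onAxis_iff 1 g).1 ⟨m, h⟩, x 0 ^ m, hx.onAxis_zpow 0 m,
      (hx.exists_commute_iff h0 (hx.onAxis_zpow 0 m) h).2 (one_mul m).symm⟩
  · rintro ⟨h1, y, hy, h2⟩
    obtain ⟨a, ha⟩ := (hx.exists_onAxis_iff 1 g).2 h1
    have := (hx.exists_commute_iff h0 hy ha).1 h2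
    rwa [this, one_mul]

@[fun_prop]
theorem dfun_onAxis_one {f : Y → G} {m : Y → ℤ} (hf : (groupCalc hx).DFun f)
    (hm : (groupCalc hx).DFun m) : (groupCalc hx).DFun (fun y => hx.OnAxis 1 (f y) (m y)) := by
  simp only [onAxis_one_iff]
  fun_prop

@[fun_prop]
theorem dfun_mul {f g : Y → ℤ} (hf : (groupCalc hx).DFun f) (hg : (groupCalc hx).DFun g) :
    (groupCalc hx).DFun (fun y => f y * g y) := by
  refine DFun.comp (g := fun p : ℤ × ℤ => p.1 * p.2) (DFun.of_graph ?_) (hf.prodMk hg)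
  have : (groupCalc hx).DFun (fun p : (ℤ × ℤ) × ℤ => ∃ g z y : G,
    hx.OnAxis 0 g p.1.1 ∧ hx.OnAxis 0 z p.2 ∧ hx.OnAxis 1 y p.1.2 ∧
      ∃ h, h * (g * x 1) = (g * x 1) * h ∧ hx.InK (z * y * h⁻¹)) := by fun_prop
  convert this using 2 with p
  constructor
  · intro e
    exact ⟨_, _, _, hx.onAxis_zpow 0 _, hx.onAxis_zpow 0 _, hx.onAxis_zpow 1 _,
      (hx.exists_commute_iff (hx.onAxis_zpow 0 _) (hx.onAxis_zpow 0 _) (hx.onAxis_zpow 1 _)).2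
        e.symm⟩
  · rintro ⟨g, z, y, hg, hz, hy, h⟩
    exact ((hx.exists_commute_iff hg hz hy).1 h).symm

/-! ### Variable powers and separating relations in the group -/

omit [Nontrivial G] in
-- Written additively, `u` is q d with q = (1 - X_0^(Np)) / (1 - X_0^p), a quotient determined by a
-- commutator equation when p ≠ 0. Since q is congruent to N modulo 1 - X_0^p, the condition says
-- that e and N d agree modulo 1 - X_0^p for all p, and these congruences together force equality.
theorem eq_zpow_iff {d e : G} (hd : hx.InK d) (he : hx.InK e) (N : ℤ) :
    d ^ N = e ↔ ∀ (p : ℤ) (g b : G), hx.OnAxis 0 g p → hx.OnAxis 0 b (N * p) →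
      ∃ u, hx.InK u ∧ ⁅u, g⁆ = ⁅d, b⁆ ∧ ∃ v, hx.InK v ∧ e = u * ⁅v, g⁆ := by
  set μ := hx.magnus with hμ
  have hdN : μ.k (d ^ N) = 0 := by rw [MagnusData.k_zpow, hd, smul_zero]
  constructor
  · rintro rfl p g b hg hb
    obtain ⟨q, s, h₁, h₂⟩ := exists_geom_sum (p • Pi.single 0 1 : Fin (n + 2) → ℤ) N
    obtain ⟨u, hu, hu'⟩ := μ.W.smul_mem q (μ.w_mem_W hd)
    obtain ⟨v, hv, hv'⟩ := μ.W.smul_mem (-s) (μ.w_mem_W hd)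
    refine ⟨u, hu, μ.ext_of_k hx ?_ ?_, v, hv, μ.ext_of_k hx ?_ ?_⟩
    · rw [μ.k_commutator, μ.k_commutator]
    · rw [OnAxis] at hg hb
      rw [μ.w_commutator hu, μ.w_commutator hd, hu', hg, hb, smul_smul, mul_smul N p, h₁]
    · rw [μ.k_mul, μ.k_commutator, hu, hdN, add_zero]
    · rw [OnAxis] at hg
      rw [μ.w_mul_of_k hu, μ.w_commutator hv, μ.w_zpow hd, hu', hv', hg, h₂, smul_smul, ← add_smul,
        mul_neg, add_neg_cancel_right, Int.cast_smul_eq_zsmul]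
  · intro h
    refine μ.ext_of_k hx (hdN.trans he.symm) ?_
    rw [μ.w_zpow hd, eq_comm, ← sub_eq_zero]
    funext l
    refine eq_zero_of_forall_dvd 0 fun p hp => ?_
    obtain ⟨u, hu, h₁, v, hv, rfl⟩ := h p _ _ (hx.onAxis_zpow 0 p) (hx.onAxis_zpow 0 (N * p))
    obtain ⟨q, s, h₂, h₃⟩ := exists_geom_sum (p • Pi.single 0 1 : Fin (n + 2) → ℤ) N
    have hne : (1 - X (p • Pi.single 0 1) : LaurentRing (n + 2)) ≠ 0 :=
      one_sub_X_ne_zero (smul_ne_zero hp fun h => one_ne_zero (Pi.single_eq_zero_iff.1 h))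
    have h₄ : μ.w u = q • μ.w d := by
      refine smul_right_cancel hne ?_
      have := congrArg μ.w h₁
      rw [μ.w_commutator hu, μ.w_commutator hd, MagnusData.k_zpow, MagnusData.k_zpow, μ.k_gen,
        mul_smul, h₂, mul_smul] at this
      exact this
    -- Here e - N d = (q - N) d + (1 - X_0^p) v and q - N = (1 - X_0^p) s.
    refine ⟨s * μ.w d l + μ.w v l, ?_⟩
    rw [μ.w_mul_of_k hu, μ.w_commutator hv, h₄, MagnusData.k_zpow, μ.k_gen, h₃]
    simp only [Pi.sub_apply, Pi.add_apply, Pi.smul_apply, smul_eq_mul]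
    rw [zsmul_eq_mul]
    ring

open Classical in
/-- Powers of elements of `K`. -/
noncomputable def powK (d : G) (N : ℤ) : G := if hx.InK d then d ^ N else 1

@[fun_prop]
theorem dfun_powK {f : Y → G} {N : Y → ℤ} (hf : (groupCalc hx).DFun f)
    (hN : (groupCalc hx).DFun N) : (groupCalc hx).DFun (fun y => hx.powK (f y) (N y)) := by
  refine DFun.comp (g := fun p : G × ℤ => hx.powK p.1 p.2) (DFun.of_graph ?_) (hf.prodMk hN)
  have : (groupCalc hx).DFun (fun q : (G × ℤ) × G =>
    (hx.InK q.1.1 ∧ hx.InK q.2 ∧ ∀ (p : ℤ) (g b : G), hx.OnAxis 0 g p →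
      hx.OnAxis 0 b (q.1.2 * p) → ∃ u, hx.InK u ∧ ⁅u, g⁆ = ⁅q.1.1, b⁆ ∧
        ∃ v, hx.InK v ∧ q.2 = u * ⁅v, g⁆) ∨ (¬ hx.InK q.1.1 ∧ 1 = q.2)) := by fun_prop
  convert this using 2 with q
  rw [powK]
  by_cases h : hx.InK q.1.1
  · rw [if_pos h]
    simp only [h, not_true_eq_false, false_and, or_false, true_and]
    constructor
    · intro e
      have he : hx.InK q.2 := by
        rw [← e, InK, MagnusData.k_zpow, h, smul_zero]
      exact ⟨he, (hx.eq_zpow_iff h he _).1 e⟩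
    · rintro ⟨he, e⟩
      exact (hx.eq_zpow_iff h he _).2 e
  · rw [if_neg h]
    simp [h]

/-- The relation `MagnusData.Sep` in terms of the operations of `G`. -/
def SepG (u : G) (N : Fin (n + 2) → ℤ) (D : ℤ) (m : Fin (n + 2) × Fin (n + 2) → ℤ) : Prop :=
  D ≠ 0 ∧ ∃ d : Fin (n + 2) → G, (∀ i, hx.InK (d i)) ∧ hx.powK u D =
    ((Finset.univ.toList).map fun p : Fin (n + 2) × Fin (n + 2) =>
      hx.powK ⁅x p.1, x p.2⁆ (m p)).prod *
    ((Finset.univ.toList).map fun i : Fin (n + 2) =>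
      x i * d i * (x i)⁻¹ * (hx.powK (d i) (N i))⁻¹).prod

@[fun_prop]
theorem dfun_sepG {u : Y → G} {N : Y → Fin (n + 2) → ℤ} {D : Y → ℤ}
    {m : Y → Fin (n + 2) × Fin (n + 2) → ℤ} (hu : (groupCalc hx).DFun u)
    (hN : (groupCalc hx).DFun N) (hD : (groupCalc hx).DFun D) (hm : (groupCalc hx).DFun m) :
    (groupCalc hx).DFun (fun y => hx.SepG (u y) (N y) (D y) (m y)) := by
  refine DFun.and (by fun_prop) (DFun.ex (DFun.and (DFun.all_fin fun i => by fun_prop)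
    (DFun.eq (by fun_prop) ?_)))
  exact DFun.group_mul (DFun.group_list_prod (fun p => by fun_prop) _)
    (DFun.group_list_prod (fun p => by fun_prop) _)

omit [Nontrivial G] in
theorem w_list_prod {ι : Type*} (f : ι → G) (hf : ∀ i, hx.InK (f i)) (l : List ι) :
    hx.InK (l.map f).prod ∧
      hx.magnus.w (l.map f).prod = (l.map fun i => hx.magnus.w (f i)).sum := by
  induction l with
  | nil => exact ⟨hx.magnus.k_one, hx.magnus.w_one⟩
  | cons i l ih =>
    simp only [List.map_cons, List.prod_cons, List.sum_cons]
    refine ⟨?_, by rw [hx.magnus.w_mul_of_k (hf i), ih.2]⟩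
    have h1 := ih.1
    have h2 := hf i
    rw [InK] at *
    rw [hx.magnus.k_mul, h1, h2, add_zero]

omit [Nontrivial G] in
theorem inK_powK (d : G) (N : ℤ) : hx.InK (hx.powK d N) := by
  rw [powK]
  split_ifs with h
  · rw [InK, MagnusData.k_zpow, h, smul_zero]
  · exact hx.magnus.k_one

omit [Nontrivial G] in
theorem w_powK {d : G} (hd : hx.InK d) (N : ℤ) :
    hx.magnus.w (hx.powK d N) = N • hx.magnus.w d := by
  rw [powK, if_pos hd, hx.magnus.w_zpow hd]

omit [Nontrivial G] in
theorem sepG_iff {u : G} (hu : hx.InK u) (N : Fin (n + 2) → ℤ) (D : ℤ)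
    (m : Fin (n + 2) × Fin (n + 2) → ℤ) :
    hx.SepG u N D m ↔ hx.magnus.Sep (hx.magnus.w u) N D m := by
  have key : ∀ d : Fin (n + 2) → G, (∀ i, hx.InK (d i)) → (hx.powK u D =
      ((Finset.univ.toList).map fun p : Fin (n + 2) × Fin (n + 2) =>
        hx.powK ⁅x p.1, x p.2⁆ (m p)).prod *
      ((Finset.univ.toList).map fun i : Fin (n + 2) =>
        x i * d i * (x i)⁻¹ * (hx.powK (d i) (N i))⁻¹).prod ↔
      D • hx.magnus.w u = ∑ p, m p • hx.magnus.w ⁅x p.1, x p.2⁆ +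
        ∑ i, (X (Pi.single i 1) • hx.magnus.w (d i) - N i • hx.magnus.w (d i))) := by
    intro d hd
    have hc : ∀ i, hx.InK (x i * d i * (x i)⁻¹) := fun i => by
      rw [InK, MagnusData.k_conj, hd i]
    have h1 := hx.w_list_prod (fun p : Fin (n + 2) × Fin (n + 2) =>
      hx.powK ⁅x p.1, x p.2⁆ (m p)) (fun p => hx.inK_powK _ _) Finset.univ.toList
    have h2 := hx.w_list_prod (fun i : Fin (n + 2) =>
      x i * d i * (x i)⁻¹ * (hx.powK (d i) (N i))⁻¹) (fun i => by
        have h3 := hc i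
        have h4 := hx.inK_powK (d i) (N i)
        rw [InK] at *
        rw [hx.magnus.k_mul, MagnusData.k_inv, h3, h4, neg_zero, add_zero]) Finset.univ.toList
    have h5 : ∀ i, hx.magnus.w (x i * d i * (x i)⁻¹ * (hx.powK (d i) (N i))⁻¹) =
        X (Pi.single i 1) • hx.magnus.w (d i) - N i • hx.magnus.w (d i) := fun i => by
      rw [hx.magnus.w_mul_of_k (hc i), hx.magnus.w_conj (hd i), hx.magnus.k_gen,
        hx.magnus.w_inv_of_k (hx.inK_powK _ _), hx.w_powK (hd i), sub_eq_add_neg]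
    have h6 : ∀ p : Fin (n + 2) × Fin (n + 2), hx.magnus.w (hx.powK ⁅x p.1, x p.2⁆ (m p)) =
        m p • hx.magnus.w ⁅x p.1, x p.2⁆ := fun p => hx.w_powK (hx.magnus.k_commutator _ _) _
    rw [← hx.w_powK hu]
    simp only [h5] at h2
    simp only [h6] at h1
    rw [Finset.sum_map_toList] at h1 h2
    rw [← h1.2, ← h2.2, ← hx.magnus.w_mul_of_k h1.1]
    refine ⟨fun h => by rw [h], fun h => hx.magnus.ext_of_k hx ?_ h⟩
    have h7 := hx.inK_powK u D
    have h8 := h1.1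
    have h9 := h2.1
    rw [InK] at h7 h8 h9
    rw [hx.magnus.k_mul, h7, h8, h9, add_zero]
  constructor
  · rintro ⟨hD, d, hd, h⟩
    exact ⟨hD, fun i => hx.magnus.w (d i), fun i => hx.magnus.w_mem_W (hd i), (key d hd).1 h⟩
  · rintro ⟨hD, d, hd, h⟩
    choose d' hd' hd'' using hd
    obtain rfl : (fun i => hx.magnus.w (d' i)) = d := funext hd''
    exact ⟨hD, d', hd', (key d' hd').2 h⟩

omit [Nontrivial G] in
theorem eq_of_sepG {u v : G} (hu : hx.InK u) (hv : hx.InK v)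
    (h : ∀ N D m, hx.SepG u N D m → hx.SepG v N D m) : u = v := by
  refine hx.magnus.ext_of_k hx (hu.trans hv.symm)
    (hx.magnus.eq_of_sep hx (hx.magnus.w_mem_W hu) fun N D m => ?_)
  rw [← hx.sepG_iff hu, ← hx.sepG_iff hv]
  exact h N D m

/-- The tuples of integers in the separating relations. -/
abbrev Params (n : ℕ) : Type :=
  (Fin (n + 2) → ℤ) × ℤ × (Fin (n + 2) × Fin (n + 2) → ℤ)

/-- The separating relation for a conjugate of a commutator. -/
def SepConj (g : G) (t : Params n) : Prop := hx.SepG (g * ⁅x 0, x 1⁆ * g⁻¹) t.1 t.2.1 t.2.2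

/-- The separating relation for the commutator with a generator. -/
def SepComm (g : G) (t : Params n) : Prop := hx.SepG ⁅g, x 0⁆ t.1 t.2.1 t.2.2

@[fun_prop]
theorem dfun_sepConj {g : Y → G} {t : Y → Params n} (hg : (groupCalc hx).DFun g)
    (ht : (groupCalc hx).DFun t) : (groupCalc hx).DFun (fun y => hx.SepConj (g y) (t y)) := by
  unfold SepConj
  fun_prop

@[fun_prop]
theorem dfun_sepComm {g : Y → G} {t : Y → Params n} (hg : (groupCalc hx).DFun g)
    (ht : (groupCalc hx).DFun t) : (groupCalc hx).DFun (fun y => hx.SepComm (g y) (t y)) := by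
  unfold SepComm
  fun_prop

omit [Nontrivial G] in
-- The conjugate of ⁅x 0, x 1⁆ by `g` determines the exponents of `g`, and then ⁅g, x 0⁆ determines
-- `g`. Both lie in K, where the integer relations separate elements.
theorem eq_iff_forall_sep (g h : G) : g = h ↔ ∀ t : Params n,
    (hx.SepConj g t ↔ hx.SepConj h t) ∧ (hx.SepComm g t ↔ hx.SepComm h t) := by
  refine ⟨fun h t => by rw [h]; exact ⟨Iff.rfl, Iff.rfl⟩, fun H => ?_⟩
  have h1 : ∀ g, hx.InK (g * ⁅x 0, x 1⁆ * g⁻¹) := fun g => by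
    rw [InK, MagnusData.k_conj, MagnusData.k_commutator]
  have h2 := hx.eq_of_sepG (h1 g) (h1 h) fun N D m => (H (N, D, m)).1.1
  exact hx.eq_of_commutator_eq (hx.k_eq_of_conj h2) (hx.eq_of_sepG (hx.magnus.k_commutator _ _)
    (hx.magnus.k_commutator _ _) fun N D m => (H (N, D, m)).2.1)

end FreeMetabelianOn

end

/-! ### Transfer of definability between the two structures -/

namespace Calc

/-- Definable predicates remain definable in a calculus that interprets the structure. -/
theorem DFun.transfer (L : FirstOrder.Language.{u, v}) {M : Type w} [L.Structure M] [Nontrivial M]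
    {A : Set M} {𝒟₀ : Calc M}
    (h₀ : ∀ {α : Type} [Finite α] {S : Set (α → M)}, 𝒟₀.Def S → A.Definable L S)
    {M' : Type w'} [Nontrivial M'] {𝒟 : Calc M'} [Rep 𝒟 M]
    (hf : ∀ {n : ℕ} (f : L.Functions n), 𝒟.DFun (fun x : Fin n → M => Structure.funMap f x))
    (hr : ∀ {n : ℕ} (r : L.Relations n), 𝒟.DFun (fun x : Fin n → M => Structure.RelMap r x))
    {X : Type*} [Rep 𝒟₀ X] [Rep 𝒟 X]
    (hπ : 𝒟.DFun (fun y : Rep.ι 𝒟₀ X → M => 𝒟₀.pr (X := X) y))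
    {P : X → Prop} (hP : 𝒟₀.DFun P) : 𝒟.DFun P := by
  -- A formula over `M` defines the pullback of `P` to tuples. It is evaluated in the copy of `M`
  -- inside `𝒟`, and `hπ` carries the result down to `X`.
  have h1 := DFun.of_definable (𝒟 := 𝒟) L hf hr (h₀ (dfun_prop_iff.1 hP))
  have h2 : 𝒟.DFun (fun x : X => ∃ y : Rep.ι 𝒟₀ X → M,
      𝒟₀.pr y = x ∧ y ∈ {y | P (𝒟₀.pr y)}) :=
    DFun.ex (DFun.and (DFun.eq (hπ.comp DFun.snd) DFun.fst) (h1.comp DFun.snd))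
  convert h2 using 2 with x
  constructor
  · intro hx
    obtain ⟨y, rfl⟩ := Rep.surj (𝒟 := 𝒟₀) x
    exact ⟨y, rfl, hx⟩
  · rintro ⟨y, rfl, hy⟩
    exact hy

end Calc

/-! ### The group inside the integers and the two coordinate maps -/

namespace FreeMetabelianOn

variable {G : Type w} [Group G] [Nontrivial G] {n : ℕ} {x : Fin (n + 2) → G}
  (hx : FreeMetabelianOn x)

omit [Nontrivial G] in
theorem isEmpty_relations (m : ℕ) (r : Language.groups.Relations m) : False :=
  nomatch (show Empty from r)

/-- The coordinate map of the interpretation of `G` in `ℤ`. -/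
noncomputable def ofInt (_hx : FreeMetabelianOn x) (z : ℤ) : G := MetabelianTerm.value x z.natAbs

omit [Nontrivial G] in
theorem ofInt_surjective : Function.Surjective hx.ofInt := fun g => by
  obtain ⟨m, hm⟩ := MetabelianTerm.value_surjective hx g
  exact ⟨m, hm⟩

/-- The group `G` as a sort of `ℤ`. -/
noncomputable abbrev groupSort : Rep intCalc G where
  ι := Unit
  fin := inferInstance
  π z := hx.ofInt (z ())
  surj g := by
    obtain ⟨z, hz⟩ := hx.ofInt_surjective g
    exact ⟨fun _ => z, hz⟩
  ker := by
    have : intCalc.DFun (fun z : Unit ⊕ Unit → ℤ => MetabelianTerm.Derivable (n + 2)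
        (z (Sum.inl ())).natAbs (z (Sum.inr ())).natAbs) :=
      MetabelianTerm.dfun_derivable (n + 2) (by fun_prop) (by fun_prop)
    exact (dfun_base_prop_iff.1 this).of_eq fun z => MetabelianTerm.value_eq_iff hx _ _

section

variable {Y : Type*} [Rep intCalc Y]

omit [Nontrivial G] in
theorem dfun_ofInt : let _ := hx.groupSort; intCalc.DFun hx.ofInt :=
  let _ := hx.groupSort
  Rep.ker (𝒟 := intCalc) (X := G)

omit [Nontrivial G] in
theorem dfun_value {f : Y → ℕ} (hf : intCalc.DFun f) :
    letI := hx.groupSort; intCalc.DFun (fun y => MetabelianTerm.value x (f y)) := by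
  let _ := hx.groupSort
  exact hx.dfun_ofInt.comp (f := fun y => (f y : ℤ)) hf.natCast

omit [Nontrivial G] in
theorem dfun_int_group_mul {f g : Y → G} :
    letI := hx.groupSort
    intCalc.DFun f → intCalc.DFun g → intCalc.DFun (fun y => f y * g y) := by
  let _ := hx.groupSort
  intro hf hg
  refine DFun.comp (g := fun p : G × G => p.1 * p.2) (DFun.of_graph ?_) (hf.prodMk hg)
  have : intCalc.DFun (fun p : (G × G) × G => ∃ a b : ℕ, MetabelianTerm.value x a = p.1.1 ∧
      MetabelianTerm.value x b = p.1.2 ∧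
        MetabelianTerm.value x (MetabelianTerm.mul a b) = p.2) :=
    DFun.ex (DFun.ex ((DFun.eq (hx.dfun_value (by fun_prop)) (by fun_prop)).and
      ((DFun.eq (hx.dfun_value (by fun_prop)) (by fun_prop)).and
        (DFun.eq (hx.dfun_value (by fun_prop)) (by fun_prop)))))
  convert this using 2 with p
  constructor
  · intro e
    obtain ⟨a, ha⟩ := MetabelianTerm.value_surjective hx p.1.1
    obtain ⟨b, hb⟩ := MetabelianTerm.value_surjective hx p.1.2
    exact ⟨a, b, ha, hb, by rw [MetabelianTerm.value_mul, ha, hb, e]⟩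
  · rintro ⟨a, b, ha, hb, e⟩
    rw [← e, MetabelianTerm.value_mul, ha, hb]

omit [Nontrivial G] in
theorem dfun_int_group_inv {f : Y → G} :
    letI := hx.groupSort
    intCalc.DFun f → intCalc.DFun (fun y => (f y)⁻¹) := by
  let _ := hx.groupSort
  intro hf
  refine DFun.comp (g := fun p : G => p⁻¹) (DFun.of_graph ?_) hf
  have : intCalc.DFun (fun p : G × G => p.1 * p.2 = 1) :=
    (hx.dfun_int_group_mul DFun.fst DFun.snd).eq (DFun.const _)
  convert this using 2 with p
  exact inv_eq_iff_mul_eq_one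

omit [Nontrivial G] in
theorem dfun_int_funMap_group {m : ℕ} (f : Language.groups.Functions m) :
    letI := hx.groupSort
    intCalc.DFun (fun y : Fin m → G => Structure.funMap f y) := by
  let _ := hx.groupSort
  cases f with
  | mul => exact hx.dfun_int_group_mul (DFun.apply 0) (DFun.apply 1)
  | inv => exact hx.dfun_int_group_inv (DFun.apply 0)
  | one => exact DFun.const 1

/-- The codes of pairs of a term for a power of the first generator and the exponent. -/
def PowerCode : ℕ → Prop :=
  RuleClosure (fun e => e = Nat.pair MetabelianTerm.one 0) fun e _ g =>
    ∃ t j, e = Nat.pair t j ∧ g = Nat.pair (MetabelianTerm.mul t (Nat.pair 0 0)) (j + 1)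

theorem dfun_powerCode : intCalc.DFun PowerCode :=
  dfun_ruleClosure (by fun_prop) (by fun_prop)

omit [Nontrivial G] in
-- Recursion on the exponent is replaced by a rule closure that builds a term and its exponent
-- together.
theorem exists_powerCode_iff (g : G) (j : ℕ) :
    g = x 0 ^ j ↔ ∃ t, MetabelianTerm.value x t = g ∧ PowerCode (Nat.pair t j) := by
  constructor
  · rintro rfl
    induction j with
    | zero => exact ⟨_, by rw [MetabelianTerm.value_one, pow_zero], .ax rfl⟩
    | succ j ih =>
      obtain ⟨t, ht, h⟩ := ih
      refine ⟨_, ?_, .step h h ⟨t, j, rfl, rfl⟩⟩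
      rw [MetabelianTerm.value_mul, ht, MetabelianTerm.value_gen, dif_pos (by omega), pow_succ]
      rfl
  · rintro ⟨t, rfl, h⟩
    have key : ∀ e, PowerCode e → MetabelianTerm.value x e.unpair.1 = x 0 ^ e.unpair.2 := by
      intro e he
      induction he with
      | ax h =>
        rw [h, Nat.unpair_pair, MetabelianTerm.value_one, pow_zero]
      | step _ _ h ih _ =>
        obtain ⟨t, j, rfl, rfl⟩ := h
        rw [Nat.unpair_pair] at ih ⊢
        dsimp only at ih ⊢
        rw [MetabelianTerm.value_mul, ih, MetabelianTerm.value_gen, dif_pos (by omega), pow_succ]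
        rfl
    have := key _ h
    rwa [Nat.unpair_pair] at this

omit [Nontrivial G] in
theorem dfun_int_zpow {z : Y → ℤ} (hz : intCalc.DFun z) :
    letI := hx.groupSort
    intCalc.DFun (fun y => x 0 ^ z y) := by
  let _ := hx.groupSort
  have hpow : intCalc.DFun (fun p : G × ℕ => p.1 = x 0 ^ p.2) := by
    have : intCalc.DFun (fun p : G × ℕ => ∃ t, MetabelianTerm.value x t = p.1 ∧
        PowerCode (Nat.pair t p.2)) :=
      DFun.ex ((DFun.eq (hx.dfun_value (by fun_prop)) (by fun_prop)).and
        (dfun_powerCode.comp (by fun_prop)))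
    convert this using 2 with p
    exact exists_powerCode_iff p.1 p.2
  refine DFun.comp (g := fun z : ℤ => x 0 ^ z) (DFun.of_graph ?_) hz
  have : intCalc.DFun (fun p : ℤ × G => (0 ≤ p.1 ∧ p.2 = x 0 ^ p.1.natAbs) ∨
      (¬ 0 ≤ p.1 ∧ p.2⁻¹ = x 0 ^ p.1.natAbs)) := by
    have h1 : intCalc.DFun (fun p : ℤ × G => p.2 = x 0 ^ p.1.natAbs) :=
      hpow.comp (f := fun p : ℤ × G => (p.2, p.1.natAbs)) (by fun_prop)
    have h2 : intCalc.DFun (fun p : ℤ × G => p.2⁻¹ = x 0 ^ p.1.natAbs) :=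
      hpow.comp (f := fun p : ℤ × G => (p.2⁻¹, p.1.natAbs))
        ((hx.dfun_int_group_inv DFun.snd).prodMk (by fun_prop))
    exact DFun.or (DFun.and (by fun_prop) h1) (DFun.and (by fun_prop) h2)
  convert this using 2 with p
  obtain ⟨z, g⟩ := p
  dsimp only
  obtain ⟨m, rfl | rfl⟩ := Int.eq_nat_or_neg z
  · simp [eq_comm]
  · rcases Nat.eq_zero_or_pos m with rfl | hm
    · simp [eq_comm]
    · simp [inv_eq_iff_eq_inv, eq_comm, hm.ne']

/-- The kernel of `toInt` is definable in `G`, hence arithmetical, and `toInt g = z` means that `g`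
is equivalent to x 0 ^ z under it. -/
theorem dfun_int_toInt {f : Y → G} :
    letI := hx.groupSort
    intCalc.DFun f → intCalc.DFun (fun y => hx.toInt (f y)) := by
  let _ := hx.groupSort
  intro hf
  refine DFun.comp (g := hx.toInt) (DFun.of_graph ?_) hf
  have h1 : (groupCalc hx).DFun (fun p : G × G => hx.toInt p.1 = hx.toInt p.2) := by fun_prop
  have h2 : intCalc.DFun (fun p : G × G => hx.toInt p.1 = hx.toInt p.2) :=
    DFun.transfer (𝒟₀ := groupCalc hx) (𝒟 := intCalc) Language.groups id hx.dfun_int_funMap_group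
      (fun r => (isEmpty_relations _ r).elim)
      ((DFun.apply (Sum.inl ())).prodMk (DFun.apply (Sum.inr ()))) h1
  have h3 : intCalc.DFun (fun p : G × ℤ => hx.toInt p.1 = hx.toInt (x 0 ^ p.2)) :=
    h2.comp (f := fun p : G × ℤ => (p.1, x 0 ^ p.2)) (DFun.fst.prodMk (hx.dfun_int_zpow DFun.snd))
  simpa only [toInt_zpow] using h3

end

theorem dfun_group_funMap_int {m : ℕ} (f : Language.ring.Functions m) :
    (groupCalc hx).DFun (fun y : Fin m → ℤ => Structure.funMap f y) := by
  cases f with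
  | add => exact hx.dfun_add (DFun.apply 0) (DFun.apply 1)
  | mul => exact hx.dfun_mul (DFun.apply 0) (DFun.apply 1)
  | neg => exact hx.dfun_neg (DFun.apply 0)
  | zero => exact DFun.const 0
  | one => exact DFun.const 1

theorem isEmpty_ring_relations (m : ℕ) (r : Language.ring.Relations m) : False :=
  nomatch (show Empty from r)

theorem dfun_int_of_dfun_group {P : G × Params n → Prop} (hP : (groupCalc hx).DFun P) :
    letI := hx.groupSort; intCalc.DFun P := by
  let _ := hx.groupSort
  refine DFun.transfer (𝒟₀ := groupCalc hx) (𝒟 := intCalc) Language.groups id hx.dfun_int_funMap_group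
    (fun r => (isEmpty_relations _ r).elim) ?_ hP
  exact (DFun.apply _).prodMk ((DFun.pi fun i => hx.dfun_int_toInt (DFun.apply _)).prodMk
    ((hx.dfun_int_toInt (DFun.apply _)).prodMk (DFun.pi fun i => hx.dfun_int_toInt (DFun.apply _))))

/-- An arithmetical relation is evaluated in the copy of ℤ on the first axis of `G`. -/
theorem dfun_group_of_dfun_int {P : ℤ × Params n → Prop} (hP : intCalc.DFun P) :
    (groupCalc hx).DFun P := by
  refine DFun.transfer (𝒟₀ := intCalc) (𝒟 := groupCalc hx) Language.ring id hx.dfun_group_funMap_int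
    (fun r => (isEmpty_ring_relations _ r).elim) ?_ hP
  exact (DFun.apply _).prodMk ((DFun.pi fun i => DFun.apply _).prodMk
    ((DFun.apply _).prodMk (DFun.pi fun i => DFun.apply _)))

/-- The evaluation of codes is definable in `G`. -/
theorem dfun_group_ofInt : (groupCalc hx).DFun hx.ofInt := by
  let _ := hx.groupSort
  -- The round trip: `P` is definable in `G`, hence arithmetical. Composing with `ofInt` makes it a
  -- relation between integers only, which is again definable in `G`.
  have h : ∀ {P : G × Params n → Prop}, (groupCalc hx).DFun P →
      (groupCalc hx).DFun (fun p : ℤ × Params n => P (hx.ofInt p.1, p.2)) := fun hP =>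
    hx.dfun_group_of_dfun_int ((hx.dfun_int_of_dfun_group hP).comp
      ((hx.dfun_ofInt.comp DFun.fst).prodMk DFun.snd))
  have h1 := h (P := fun p => hx.SepConj p.1 p.2) (by fun_prop)
  have h2 := h (P := fun p => hx.SepComm p.1 p.2) (by fun_prop)
  refine DFun.of_graph ?_
  -- The equation `ofInt z = g` now mentions `ofInt z` only through relations covered by the round
  -- trip.
  simp only [hx.eq_iff_forall_sep]
  have h3 : (groupCalc hx).DFun (fun q : (ℤ × G) × Params n => hx.SepConj (hx.ofInt q.1.1) q.2) :=
    h1.comp (f := fun q : (ℤ × G) × Params n => (q.1.1, q.2)) (by fun_prop)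
  have h4 : (groupCalc hx).DFun (fun q : (ℤ × G) × Params n => hx.SepComm (hx.ofInt q.1.1) q.2) :=
    h2.comp (f := fun q : (ℤ × G) × Params n => (q.1.1, q.2)) (by fun_prop)
  exact DFun.all (DFun.and (h3.iff (by fun_prop)) (h4.iff (by fun_prop)))

end FreeMetabelianOn

/-! ### Assembling the bi-interpretation -/

theorem mem_fullPreimage_coe {M : Type w} {N : Type w'} {ι κ : Type} (f : (ι → N) → M)
    (S : Set (κ → M)) (y : κ × ι → N) :
    y ∈ fullPreimage (f : (ι → N) →. M) S ↔ (fun k => f fun i => y (k, i)) ∈ S := by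
  constructor
  · rintro ⟨a, ha, h⟩
    obtain rfl : a = fun k => f fun i => y (k, i) := funext fun k => Part.mem_some_iff.1 (h k)
    exact ha
  · exact fun h => ⟨_, h, fun k => Part.mem_some _⟩

/-- The interpretation given by a sort with a one-dimensional total coordinate map. -/
def Interpretation.ofTotal (L : FirstOrder.Language.{u, v}) {M : Type w} [L.Structure M]
    (L' : FirstOrder.Language.{u', v'}) {N : Type w'} [L'.Structure N] [Nontrivial N] {m : ℕ}
    (par : Fin m → N) (𝒟 : Calc N)
    (h : ∀ {α : Type} [Finite α] {S : Set (α → N)}, 𝒟.Def S → (Set.range par).Definable L' S)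
    [Rep 𝒟 M] (f : N → M) (hs : Function.Surjective f) (hd : 𝒟.DFun f)
    (hf : ∀ {n : ℕ} (φ : L.Functions n), 𝒟.DFun (fun y : Fin n → M => Structure.funMap φ y))
    (hr : ∀ {n : ℕ} (r : L.Relations n), 𝒟.DFun (fun y : Fin n → M => Structure.RelMap r y)) :
    Interpretation L M L' N :=
  have key : ∀ {k : ℕ} {S : Set (Fin k → M)}, 𝒟.DFun (fun y : Fin k → M => y ∈ S) →
      (Set.range par).Definable L'
        (fullPreimage ((fun y : Fin 1 → N => f (y 0) : (Fin 1 → N) → M) : (Fin 1 → N) →. M) S) :=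
    fun {k S} hS => by
      have h1 : 𝒟.DFun (fun y : Fin k × Fin 1 → N => (fun k => f (y (k, 0))) ∈ S) :=
        hS.comp (DFun.pi fun k => hd.comp (DFun.apply _))
      exact h ((dfun_base_prop_iff.1 h1).of_eq fun y => mem_fullPreimage_coe _ _ _)
  { dim := 1
    parDim := m
    par := par
    coord := ((fun y : Fin 1 → N => f (y 0) : (Fin 1 → N) → M) : (Fin 1 → N) →. M)
    surjective := fun a => by
      obtain ⟨b, rfl⟩ := hs a
      exact ⟨fun _ => b, Part.mem_some _⟩
    definable_dom := Set.definable_univ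
    definable_ker := key (S := {a | a 0 = a 1}) ((DFun.apply 0).eq (DFun.apply 1))
    definable_fun := fun {k} φ => key
      (S := {a : Fin (k + 1) → M | Structure.funMap φ (fun i => a (Fin.castSucc i)) = a (Fin.last k)})
      (((hf φ).comp (DFun.pi fun i => DFun.apply _)).eq (DFun.apply _))
    definable_rel := fun r => key (S := {a | Structure.RelMap r a}) (hr r) }

/-- The composition of two one-dimensional total interpretations has a definable coordinate map if
the coordinate map of the first is definable in the target of the second. -/
theorem Interpretation.hasDefinableCompIso_ofTotal (L : FirstOrder.Language.{u, v}) {M : Type w}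
    [L.Structure M] [Nontrivial M] (L' : FirstOrder.Language.{u', v'}) {N : Type w'}
    [L'.Structure N] [Nontrivial N] {m m' : ℕ} (par : Fin m → N) (par' : Fin m' → M)
    (𝒟 : Calc N) (𝒟' : Calc M)
    (h : ∀ {α : Type} [Finite α] {S : Set (α → N)}, 𝒟.Def S → (Set.range par).Definable L' S)
    (h' : ∀ {α : Type} [Finite α] {S : Set (α → M)}, 𝒟'.Def S → (Set.range par').Definable L S)
    [Rep 𝒟 M] [Rep 𝒟' N] (f : N → M) (hs : Function.Surjective f) (hd : 𝒟.DFun f)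
    (hf : ∀ {n : ℕ} (φ : L.Functions n), 𝒟.DFun (fun y : Fin n → M => Structure.funMap φ y))
    (hr : ∀ {n : ℕ} (r : L.Relations n), 𝒟.DFun (fun y : Fin n → M => Structure.RelMap r y))
    (f' : M → N) (hs' : Function.Surjective f') (hd' : 𝒟'.DFun f')
    (hf' : ∀ {n : ℕ} (φ : L'.Functions n), 𝒟'.DFun (fun y : Fin n → N => Structure.funMap φ y))
    (hr' : ∀ {n : ℕ} (r : L'.Relations n), 𝒟'.DFun (fun y : Fin n → N => Structure.RelMap r y))
    (hc : 𝒟'.DFun f) :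
    (Interpretation.ofTotal L L' par 𝒟 h f hs hd hf hr).HasDefinableCompIso
      (Interpretation.ofTotal L' L par' 𝒟' h' f' hs' hd' hf' hr') := by
  -- Any preimages of the parameters will do. The automorphism is the identity, since the composite
  -- coordinate map is itself definable.
  choose p₀ hp₀ using fun k => hs' (par k)
  refine ⟨fun k _ => p₀ k, fun k => Part.mem_some_iff.2 (hp₀ k).symm,
    Language.Equiv.refl L M, ?_⟩
  have h1 : 𝒟'.DFun (fun y : (Fin 1 × Fin 1) ⊕ Unit → M =>
      y (Sum.inr ()) = f (f' (y (Sum.inl (0, 0))))) :=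
    (DFun.apply _).eq (hc.comp (hd'.comp (DFun.apply _)))
  have h2 : (Set.range par').Definable L {y : (Fin 1 × Fin 1) ⊕ Unit → M |
      ∃ a : M, (Interpretation.ofTotal L L' par 𝒟 h f hs hd hf hr).CompRel
        (Interpretation.ofTotal L' L par' 𝒟' h' f' hs' hd' hf' hr')
          (fun ij => y (Sum.inl ij)) a ∧ y (Sum.inr ()) = (Language.Equiv.refl L M) a} := by
    refine h' ((dfun_base_prop_iff.1 h1).of_eq fun y => ?_)
    constructor
    · rintro ⟨a, ⟨b, hb, hab⟩, e⟩
      have hb0 : b (0 : Fin 1) = f' (y (Sum.inl (0, 0))) := Part.mem_some_iff.1 (hb (0 : Fin 1))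
      have ha : a = f (b (0 : Fin 1)) := Part.mem_some_iff.1 hab
      exact e.trans (ha.trans (congrArg f hb0))
    · intro e
      refine ⟨f (f' (y (Sum.inl (0, 0)))), ⟨fun _ => f' (y (Sum.inl (0, 0))), fun i => ?_,
        Part.mem_some _⟩, e⟩
      obtain rfl : i = (0 : Fin 1) := Subsingleton.elim (α := Fin 1) _ _
      exact Part.mem_some _
  exact h2.mono Set.subset_union_right

theorem mainTheorem1 (n : ℕ) (hn : 2 ≤ n) (G : Type w) [Group G]
    (hG : IsFreeMetabelianOfRank G n) :
    FirstOrder.BiInterpretable FirstOrder.Language.groups G FirstOrder.Language.ring ℤ := by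
  obtain ⟨x, hx⟩ := FreeMetabelianOn.exists_of_isFreeMetabelianOfRank hG
  obtain ⟨n, rfl⟩ := Nat.exists_eq_add_of_le' hn
  have : Nontrivial G := ⟨⁅x 0, x 1⁆, 1, fun h => hx.w_commutator_ne_zero (by
    rw [h, MagnusData.w_one])⟩
  let _ := hx.groupSort
  have h₁ : ∀ {α : Type} [Finite α] {S : Set (α → ℤ)}, intCalc.Def S →
      (Set.range (Fin.elim0 : Fin 0 → ℤ)).Definable Language.ring S := fun {α} _ {S} hS => by
    have : (∅ : Set ℤ).Definable Language.ring S := hS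
    exact this.mono (Set.empty_subset _)
  have h₂ : ∀ {α : Type} [Finite α] {S : Set (α → G)}, (groupCalc hx).Def S →
      (Set.range x).Definable Language.groups S := id
  have hs : Function.Surjective hx.toInt := fun m => ⟨_, hx.toInt_zpow m⟩
  -- On the side of ℤ no parameters are needed; on the side of `G` the free generators serve.
  refine ⟨Interpretation.ofTotal Language.groups Language.ring _ intCalc h₁ hx.ofInt
      hx.ofInt_surjective hx.dfun_ofInt hx.dfun_int_funMap_group
      (fun r => (FreeMetabelianOn.isEmpty_relations _ r).elim),
    Interpretation.ofTotal Language.ring Language.groups x (groupCalc hx) h₂ hx.toInt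
      hs hx.dfun_toInt' hx.dfun_group_funMap_int
      (fun r => (FreeMetabelianOn.isEmpty_ring_relations _ r).elim), ?_, ?_⟩
  · exact Interpretation.hasDefinableCompIso_ofTotal _ _ _ _ _ _ _ _ _ _ _ _ _ _ _ _ _ _
      hx.dfun_group_ofInt
  · exact Interpretation.hasDefinableCompIso_ofTotal _ _ _ _ _ _ _ _ _ _ _ _ _ _ _ _ _ _
      (hx.dfun_int_toInt DFun.id)
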